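/- **Confluence of parallel reduction for System DR.** *Syntax.* Roles are $R::=\mathsf{Nom}\mid\mathsf{Rep}$, ordered by $\mathsf{Nom}\le\mathsf{Rep}$, with minimum $\wedge$. Relevance is $\rho::=+\mid-$, and flags are $\nu::=R\mid\rho$ and $\upsilon::=\nu\mid\bullet$. With $x$ ranging over variables and $F$ over a set of constants, terms (up to renaming of bound variables) are $$a,b,A,B::=\star\mid x\mid F\mid\lambda^\rho x.b\mid a\,b^\nu\mid\Box\mid\Pi^\rho x{:}A\to B\mid\Lambda c.b\mid a\,\bullet\mid\forall c{:}(a\sim_R b:A).B\mid\mathsf{case}\ a\ \mathsf{of}\ F\,\overline\upsilon\to b_1\,\|\,\_\to b_2 .$$ Coercion variables $c$ do not occur in terms. Patterns are $p::=F\mid p\,x^R\mid p\,x^+\mid p\,\Box^-\mid p\,\bullet$ with distinct variables, and paths are $w::=F\mid w\,b^R\mid w\,b^+\mid w\,\Box^-\mid w\,\bullet$. A pattern determines a context $\Omega_p$ giving role $R$ to each variable $x^R$ and role $\mathsf{Nom}$ to each variable $x^+$. For an argument with flag $\nu$ put $\nu\triangleright R=R_1\wedge R$ if $\nu=R_1$,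 and $\nu\triangleright R=\mathsf{Nom}$ if $\nu=\rho$. *Role-checking.* $\Omega\vDash a:R$, where $\Omega$ assigns roles to variables, is the least relation such that: $\star$, $\Box$ and every declared constant have every role; $\Omega\vDash x:R_1$ if $x{:}R\in\Omega$ and $R\le R_1$; $\lambda^\rho x.b$ has role $R$ if $\Omega,x{:}\mathsf{Nom}\vDash b:R$; $a\,b^\nu$ has role $R$ if $\Omega\vDash a:R$ and $\Omega\vDash b:\nu\triangleright R$; $\Pi^\rho x{:}A\to B$ has role $R$ if $\Omega\vDash A:R$ and $\Omega,x{:}\mathsf{Nom}\vDash B:R$; $\forall c{:}(a\sim_{R_1}b:A).B$ has role $R$ if $a,b$ have role $R_1$, $A$ has some role and $B$ has role $R$; $\Lambda c.b$ and $b\,\bullet$ have role $R$ if $b$ has; and $\mathsf{case}\ a\ \mathsf{of}\ F\,\overline\upsilon\to b_1\|\_\to b_2$ has role $R$ if $a$ has role $\mathsf{Nom}$ and $b_1,b_2$ have role $R$. *Signatures.* Fix a finite signature $\Sigma_0$ of declarations $F:A\,@\,\overline R$ (constants) and $F:A\,@\,\overline R\ \mathsf{where}\ p\sim_R a$ (axioms).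 It is assumed to be well formed in the following (typing-independent) sense: each constant is declared at most once; and for every axiom, $p$ is headed by $F$, $\overline R$ is the list of roles of $\Omega_p$ in order, and $\Omega_p\vDash a:R$. *Matching and values.* A path agrees with $p$ if it is obtained from $p$ by replacing its variables by terms (role annotations and flags coinciding); $\mathsf{MatchSubst}(a,p,b)$ is the result of substituting these terms for the variables of $p$ in $b$. $\mathsf{CasePath}_R\,a=F$ means that $a$ is a path headed by $F$ and $F$ is either declared as a constant, or declared by an axiom $p\sim_{R_1}b$ such that $R_1\not\le R$ or no prefix of $a$ agrees with $p$. The values at role $R$ are $\star$, all $\Pi$- and $\forall$-types, all $\lambda^+x.b$ and $\Lambda c.b$, those $\lambda^-x.b$ with $b$ a value at role $R$, and all $a$ with $\mathsf{CasePath}_R\,a=F$ for some $F$. Write $a\leftrightarrow_R F\,\overline\upsilon$ if $a$ is a path headed by $F$ whose arguments have flags $\overline\upsilon$, where $F$ is a constant or has an axiom of role $R_1\not\le R$. $\mathsf{ApplyArgs}(a,b)$ applies $b$ to the arguments of the path $a$ in order, keeping the flags $+,-,\bullet$ and replacing each role flag by $+$. $\overline\upsilon$ saturates $F$ if the list obtained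 from $\overline\upsilon$ by deleting $-$ and $\bullet$ and replacing $+$ by $\mathsf{Nom}$ is the list of roles declared for $F$. *Parallel reduction.* $\Omega\vDash a\Rightarrow_R a'$ is the least relation closed under: 1. $\Omega\vDash a\Rightarrow_R a$ if $\Omega\vDash a:R$. 2. If $\Omega\vDash a\Rightarrow_R\lambda^\rho x.a'$ and $\Omega\vDash b\Rightarrow_{\mathsf{Nom}}b'$, then $\Omega\vDash a\,b^\rho\Rightarrow_R a'\{b'/x\}$. If $\Omega\vDash a\Rightarrow_R\Lambda c.a'$, then $\Omega\vDash a\,\bullet\Rightarrow_R a'$. 3. Congruence for $\lambda^\rho$, $\Pi^\rho$, $\Lambda$, application, $a\,\bullet$, $\forall c$ and $\mathsf{case}$, where each component is reduced at the role, and in the context, at which role-checking checks it (for $A$ in $\forall c{:}(a\sim_{R_1}b:A).B$: at any one role). 4. Let $F:A\,@\,\overline R\ \mathsf{where}\ p\sim_{R_1}b$ be in $\Sigma_0$ with $R_1\le R$. If $p=F$, then $\Omega\vDash F\Rightarrow_R b$. If $a\,a_1^\nu$ agrees with $p$, $\Omega\vDash a\Rightarrow_R a'$ and $\Omega\vDash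 a_1\Rightarrow_{\nu\triangleright R}a_1'$, then $\Omega\vDash a\,a_1^\nu\Rightarrow_R\mathsf{MatchSubst}(a'\,a_1'^{\,\nu},p,b)$ whenever the latter is defined. If $a\,\bullet$ agrees with $p$ and $\Omega\vDash a\Rightarrow_R a'$, then $\Omega\vDash a\,\bullet\Rightarrow_R\mathsf{MatchSubst}(a'\,\bullet,p,b)$ whenever the latter is defined. 5. Suppose $\Omega\vDash a\Rightarrow_{\mathsf{Nom}}a'$, $\Omega\vDash b_1\Rightarrow_R b_1'$ and $\Omega\vDash b_2\Rightarrow_R b_2'$. If $a'\leftrightarrow_{\mathsf{Nom}}F\,\overline\upsilon$ and $\overline\upsilon$ saturates $F$, then $\Omega\vDash\mathsf{case}\ a\ \mathsf{of}\ F\,\overline\upsilon\to b_1\|\_\to b_2\Rightarrow_R\mathsf{ApplyArgs}(a',b_1')\,\bullet$. If $a'$ is a value at role $\mathsf{Nom}$ and $a'\leftrightarrow_{\mathsf{Nom}}F\,\overline\upsilon$ does not hold, then $\Omega\vDash\mathsf{case}\ a\ \mathsf{of}\ F\,\overline\upsilon\to b_1\|\_\to b_2\Rightarrow_R b_2'$.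 **Lemma (Confluence).** For all $\Omega,R,a,a_1,a_2$: if $\Omega\vDash a\Rightarrow_R a_1$ and $\Omega\vDash a\Rightarrow_R a_2$, then there exists a term $b$ such that $\Omega\vDash a_1\Rightarrow_R b$ and $\Omega\vDash a_2\Rightarrow_R b$. -/

import Mathlib

namespace SystemDR

universe u

/-! ## Roles and flags -/

/-- Roles: nominal and representational. -/
inductive Role : Type
  | nom
  | rep

/-- The role ordering, with bottom `nom` and top `rep`. -/
inductive SubRole : Role → Role → Prop
  | nomBot (R : Role) : SubRole .nom R
  | repTop (R : Role) : SubRole R .rep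
  | refl (R : Role) : SubRole R R
  | trans {R₁ R₂ R₃ : Role} : SubRole R₁ R₂ → SubRole R₂ R₃ → SubRole R₁ R₃

/-- The minimum `R₁ ∧ R₂` of two roles. -/
def Role.meet : Role → Role → Role
  | .nom, _ => .nom
  | _, .nom => .nom
  | .rep, .rep => .rep

/-- Relevance `ρ`: `+` (relevant) or `-` (irrelevant). -/
inductive Relevance : Type
  | rel
  | irr

/-- Term application flags `ν ::= R | ρ`. -/
inductive AppFlag : Type
  | role (R : Role)
  | rho (r : Relevance)

/-- Arbitrary application flags `υ ::= ν | •`. -/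
inductive AnyFlag : Type
  | tm (ν : AppFlag)
  | co

/-- The role at which the argument of an application with flag `ν` is considered, when the
application itself is considered at role `R`. -/
def AppFlag.argRole : AppFlag → Role → Role
  | .role R₁, R => Role.meet R₁ R
  | .rho _, _ => .nom

/-! ## Terms

Terms up to renaming of bound variables, in de Bruijn notation. Only `lam` and (the codomain of)
`pi` bind a term variable. Coercion variables have no occurrences in terms, as coercion
arguments are elided to `•`, so the coercion binders `Λc. b` and `∀c:φ. B` bind no index. -/

/-- Terms and types over a set `K` of constants. -/
inductive Tm (K : Type u) : Type u
  /-- `⋆` -/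
  | star
  /-- a term variable -/
  | var (i : ℕ)
  /-- a constant `F` -/
  | fam (F : K)
  /-- `λ^ρ x. b` -/
  | lam (ρ : Relevance) (b : Tm K)
  /-- `a b^ν` -/
  | app (a : Tm K) (ν : AppFlag) (b : Tm K)
  /-- the trivial term `□` -/
  | box
  /-- `Π^ρ x:A → B` -/
  | pi (ρ : Relevance) (A B : Tm K)
  /-- `Λc. b` -/
  | clam (b : Tm K)
  /-- `a •` -/
  | capp (a : Tm K)
  /-- `∀c : (a ∼_R b : A). B` -/
  | cpi (a b A : Tm K) (R : Role) (B : Tm K)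
  /-- `case a of F υs → b₁ ‖ _ → b₂` -/
  | case (a : Tm K) (F : K) (υs : List AnyFlag) (b₁ b₂ : Tm K)

namespace Tm

variable {K : Type u}

/-- Extend a renaming under a binder. -/
def upRen (ξ : ℕ → ℕ) : ℕ → ℕ
  | 0 => 0
  | i + 1 => ξ i + 1

/-- Renaming of free variables. -/
def rename : (ℕ → ℕ) → Tm K → Tm K
  | _, star => star
  | ξ, var i => var (ξ i)
  | _, fam F => fam F
  | ξ, lam ρ b => lam ρ (rename (upRen ξ) b)
  | ξ, app a ν b => app (rename ξ a) ν (rename ξ b)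
  | _, box => box
  | ξ, pi ρ A B => pi ρ (rename ξ A) (rename (upRen ξ) B)
  | ξ, clam b => clam (rename ξ b)
  | ξ, capp a => capp (rename ξ a)
  | ξ, cpi a b A R B => cpi (rename ξ a) (rename ξ b) (rename ξ A) R (rename ξ B)
  | ξ, case a F υs b₁ b₂ => case (rename ξ a) F υs (rename ξ b₁) (rename ξ b₂)

/-- Extend a substitution under a binder. -/
def up (σ : ℕ → Tm K) : ℕ → Tm K
  | 0 => var 0
  | i + 1 => rename Nat.succ (σ i)

/-- Simultaneous capture-avoiding substitution. -/
def subst : (ℕ → Tm K) → Tm K → Tm K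
  | _, star => star
  | σ, var i => σ i
  | _, fam F => fam F
  | σ, lam ρ b => lam ρ (subst (up σ) b)
  | σ, app a ν b => app (subst σ a) ν (subst σ b)
  | _, box => box
  | σ, pi ρ A B => pi ρ (subst σ A) (subst (up σ) B)
  | σ, clam b => clam (subst σ b)
  | σ, capp a => capp (subst σ a)
  | σ, cpi a b A R B => cpi (subst σ a) (subst σ b) (subst σ A) R (subst σ B)
  | σ, case a F υs b₁ b₂ => case (subst σ a) F υs (subst σ b₁) (subst σ b₂)

/-- The substitution sending the variables `0, …, n - 1` to the `n` listed terms and lowering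
the remaining variables by `n`. -/
def ofList : List (Tm K) → ℕ → Tm K
  | [], i => var i
  | a :: _, 0 => a
  | _ :: as, i + 1 => ofList as i

/-- `b {a / x}`, where `x` is the variable of index `0` of `b`. -/
def inst (b a : Tm K) : Tm K := subst (ofList [a]) b

end Tm

/-! ## Patterns and signatures -/

/-- Patterns `p ::= F | p x^R | p x^+ | p □^- | p •`. The variables of a pattern are distinct and
are bound in the right-hand side of its axiom; they are left nameless here. In a right-hand side
index `0` is the last (outermost) variable of the pattern. -/
inductive Pat (K : Type u) : Type u
  | fam (F : K)
  | appRole (p : Pat K) (R : Role)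
  | appRel (p : Pat K)
  | appIrr (p : Pat K)
  | capp (p : Pat K)

namespace Pat

variable {K : Type u}

/-- The constant at the head of a pattern. -/
def head : Pat K → K
  | fam F => F
  | appRole p _ => p.head
  | appRel p => p.head
  | appIrr p => p.head
  | capp p => p.head

/-- The role-checking context of a pattern: a variable `x^R` has role `R`, and a variable
without a role annotation has role `nom`. The last variable comes first. -/
def ctx : Pat K → List Role
  | fam _ => []
  | appRole p R => R :: p.ctx
  | appRel p => .nom :: p.ctx
  | appIrr p => p.ctx
  | capp p => p.ctx

end Pat

/-- Declarations: `F : A @ Rs` and `F : A @ Rs where p ∼_R a`. -/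
inductive Decl (K : Type u) : Type u
  | const (A : Tm K) (Rs : List Role)
  | ax (A : Tm K) (Rs : List Role) (p : Pat K) (R : Role) (a : Tm K)

/-- Signatures. -/
abbrev Sig (K : Type u) : Type u := List (K × Decl K)

/-! ## Role-checking -/

/-- `Ω ⊨ a : R`. A role-checking context `Ω` lists the roles of the variables `0, 1, …`. -/
inductive Roleing {K : Type u} (S : Sig K) : List Role → Tm K → Role → Prop
  | star {Ω : List Role} {R : Role} : Roleing S Ω .star R
  | box {Ω : List Role} {R : Role} : Roleing S Ω .box R
  | var {Ω : List Role} {i : ℕ} {R R₁ : Role} :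
      (Ω)[i]? = some R → SubRole R R₁ → Roleing S Ω (.var i) R₁
  | const {Ω : List Role} {F : K} {A : Tm K} {Rs : List Role} {R : Role} :
      (F, Decl.const A Rs) ∈ S → Roleing S Ω (.fam F) R
  | ax {Ω : List Role} {F : K} {A : Tm K} {Rs : List Role} {p : Pat K} {R₁ : Role} {a : Tm K}
      {R : Role} :
      (F, Decl.ax A Rs p R₁ a) ∈ S → Roleing S Ω (.fam F) R
  | lam {Ω : List Role} {ρ : Relevance} {b : Tm K} {R : Role} :
      Roleing S (.nom :: Ω) b R → Roleing S Ω (.lam ρ b) R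
  | app {Ω : List Role} {a b : Tm K} {ρ : Relevance} {R : Role} :
      Roleing S Ω a R → Roleing S Ω b .nom → Roleing S Ω (.app a (.rho ρ) b) R
  | tapp {Ω : List Role} {a b : Tm K} {R₁ R : Role} :
      Roleing S Ω a R → Roleing S Ω b (Role.meet R₁ R) → Roleing S Ω (.app a (.role R₁) b) R
  | pi {Ω : List Role} {ρ : Relevance} {A B : Tm K} {R : Role} :
      Roleing S Ω A R → Roleing S (.nom :: Ω) B R → Roleing S Ω (.pi ρ A B) R
  | cpi {Ω : List Role} {a b A B : Tm K} {R₀ R₁ R : Role} :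
      Roleing S Ω a R₁ → Roleing S Ω b R₁ → Roleing S Ω A R₀ → Roleing S Ω B R →
      Roleing S Ω (.cpi a b A R₁ B) R
  | clam {Ω : List Role} {b : Tm K} {R : Role} :
      Roleing S Ω b R → Roleing S Ω (.clam b) R
  | capp {Ω : List Role} {a : Tm K} {R : Role} :
      Roleing S Ω a R → Roleing S Ω (.capp a) R
  | case {Ω : List Role} {a : Tm K} {F : K} {υs : List AnyFlag} {b₁ b₂ : Tm K} {R : Role} :
      Roleing S Ω a .nom → Roleing S Ω b₁ R → Roleing S Ω b₂ R →
      Roleing S Ω (.case a F υs b₁ b₂) R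

/-! ## Signature checking -/

/-- The part of signature checking that does not mention typing: constants are declared once,
the pattern of an axiom for `F` is headed by `F`, the roles declared for `F` are those of the
pattern variables, and the right-hand side role-checks, in the context given by the pattern, at
the role of the axiom. Right-hand sides are checked against the whole signature `S₀`, since
axioms may be recursive. -/
inductive SigOk {K : Type u} (S₀ : Sig K) : Sig K → Prop
  | empty : SigOk S₀ []
  | consConst {S : Sig K} {F : K} {A : Tm K} {Rs : List Role} :
      SigOk S₀ S → F ∉ S.map Prod.fst → SigOk S₀ ((F, .const A Rs) :: S)
  | consAx {S : Sig K} {F : K} {A : Tm K} {Rs : List Role} {p : Pat K} {R : Role} {a : Tm K} :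
      SigOk S₀ S → F ∉ S.map Prod.fst → p.head = F → Rs = p.ctx.reverse →
      Roleing S₀ p.ctx a R → SigOk S₀ ((F, .ax A Rs p R a) :: S)

/-! ## Matching, paths and values -/

/-- `Match a p as`: the application path `a` is an instance of the pattern `p`, with the terms
`as` for the pattern variables (last variable first). -/
inductive Match {K : Type u} : Tm K → Pat K → List (Tm K) → Prop
  | fam {F : K} : Match (.fam F) (.fam F) []
  | appRole {a b : Tm K} {p : Pat K} {R : Role} {as : List (Tm K)} :
      Match a p as → Match (.app a (.role R) b) (.appRole p R) (b :: as)
  | appRel {a b : Tm K} {p : Pat K} {as : List (Tm K)} :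
      Match a p as → Match (.app a (.rho .rel) b) (.appRel p) (b :: as)
  | appIrr {a : Tm K} {p : Pat K} {as : List (Tm K)} :
      Match a p as → Match (.app a (.rho .irr) .box) (.appIrr p) as
  | capp {a : Tm K} {p : Pat K} {as : List (Tm K)} :
      Match a p as → Match (.capp a) (.capp p) as

/-- The term `a` agrees with the pattern `p`. -/
def PatAgree {K : Type u} (a : Tm K) (p : Pat K) : Prop := ∃ as, Match a p as

/-- `MatchSubst (a, p, b₁) = b₂`: match `a` against `p` and apply the resulting substitution
to `b₁`. -/
def MatchSubst {K : Type u} (a : Tm K) (p : Pat K) (b₁ b₂ : Tm K) : Prop :=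
  ∃ as, Match a p as ∧ b₂ = b₁.subst (Tm.ofList as)

/-- Some prefix of the application `a` agrees with the pattern `p`. -/
inductive PrefixAgree {K : Type u} : Tm K → Pat K → Prop
  | base {a : Tm K} {p : Pat K} : PatAgree a p → PrefixAgree a p
  | app {a b : Tm K} {ν : AppFlag} {p : Pat K} :
      PrefixAgree a p → PrefixAgree (.app a ν b) p
  | capp {a : Tm K} {p : Pat K} : PrefixAgree a p → PrefixAgree (.capp a) p

/-- `a` is an application path `F | w b^R | w b^+ | w □^- | w •` headed by the declared
constant `F`. -/
inductive ValuePath {K : Type u} (S : Sig K) : Tm K → K → Prop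
  | const {F : K} {d : Decl K} : (F, d) ∈ S → ValuePath S (.fam F) F
  | appRole {a b : Tm K} {R : Role} {F : K} :
      ValuePath S a F → ValuePath S (.app a (.role R) b) F
  | appRel {a b : Tm K} {F : K} : ValuePath S a F → ValuePath S (.app a (.rho .rel) b) F
  | appIrr {a : Tm K} {F : K} : ValuePath S a F → ValuePath S (.app a (.rho .irr) .box) F
  | capp {a : Tm K} {F : K} : ValuePath S a F → ValuePath S (.capp a) F

/-- `CasePath_R a = F`: `a` is a path headed by `F` that cannot reduce at role `R`. -/
inductive CasePath {K : Type u} (S : Sig K) (R : Role) : Tm K → K → Prop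
  | absConst {a : Tm K} {F : K} {A : Tm K} {Rs : List Role} :
      ValuePath S a F → (F, Decl.const A Rs) ∈ S → CasePath S R a F
  | const {a : Tm K} {F : K} {A : Tm K} {Rs : List Role} {p : Pat K} {R₁ : Role} {b : Tm K} :
      ValuePath S a F → (F, Decl.ax A Rs p R₁ b) ∈ S → ¬ SubRole R₁ R → CasePath S R a F
  | unMatch {a : Tm K} {F : K} {A : Tm K} {Rs : List Role} {p : Pat K} {R₁ : Role} {b : Tm K} :
      ValuePath S a F → (F, Decl.ax A Rs p R₁ b) ∈ S → ¬ PrefixAgree a p → CasePath S R a F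

/-- `Value_R a`. -/
inductive Value {K : Type u} (S : Sig K) (R : Role) : Tm K → Prop
  | star : Value S R .star
  | pi {ρ : Relevance} {A B : Tm K} : Value S R (.pi ρ A B)
  | cpi {a b A B : Tm K} {R₁ : Role} : Value S R (.cpi a b A R₁ B)
  | lamRel {b : Tm K} : Value S R (.lam .rel b)
  | lamIrr {b : Tm K} : Value S R b → Value S R (.lam .irr b)
  | clam {b : Tm K} : Value S R (.clam b)
  | path {a : Tm K} {F : K} : CasePath S R a F → Value S R a

/-- `a ↔_R F υs`: the term `a` is a path headed by `F`, which is a constant at role `R`, and the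
flags of its arguments are `υs`, from left to right. -/
inductive AppsPath {K : Type u} (S : Sig K) (R : Role) : Tm K → K → List AnyFlag → Prop
  | absConst {F : K} {A : Tm K} {Rs : List Role} :
      (F, Decl.const A Rs) ∈ S → AppsPath S R (.fam F) F []
  | const {F : K} {A : Tm K} {Rs : List Role} {p : Pat K} {R₁ : Role} {b : Tm K} :
      (F, Decl.ax A Rs p R₁ b) ∈ S → ¬ SubRole R₁ R → AppsPath S R (.fam F) F []
  | appRole {a b : Tm K} {R₁ : Role} {F : K} {υs : List AnyFlag} :
      AppsPath S R a F υs →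
      AppsPath S R (.app a (.role R₁) b) F (υs ++ [.tm (.role R₁)])
  | appRel {a b : Tm K} {F : K} {υs : List AnyFlag} :
      AppsPath S R a F υs →
      AppsPath S R (.app a (.rho .rel) b) F (υs ++ [.tm (.rho .rel)])
  | appIrr {a : Tm K} {F : K} {υs : List AnyFlag} :
      AppsPath S R a F υs →
      AppsPath S R (.app a (.rho .irr) .box) F (υs ++ [.tm (.rho .irr)])
  | capp {a : Tm K} {F : K} {υs : List AnyFlag} :
      AppsPath S R a F υs → AppsPath S R (.capp a) F (υs ++ [.co])

/-- `ApplyArgs a b = b'`: pass the arguments of the path `a` on to `b`. Role annotations of the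
arguments are dropped. -/
inductive ApplyArgs {K : Type u} : Tm K → Tm K → Tm K → Prop
  | const {F : K} {b : Tm K} : ApplyArgs (.fam F) b b
  | appRole {a a' b b' : Tm K} {R : Role} :
      ApplyArgs a b b' → ApplyArgs (.app a (.role R) a') b (.app b' (.rho .rel) a')
  | appRho {a a' b b' : Tm K} {ρ : Relevance} :
      ApplyArgs a b b' → ApplyArgs (.app a (.rho ρ) a') b (.app b' (.rho ρ) a')
  | capp {a b b' : Tm K} : ApplyArgs a b b' → ApplyArgs (.capp a) b (.capp b')

/-- The roles of the relevant arguments in a list of flags; `+` counts as `nom`. -/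
def appRoles : List AnyFlag → List Role
  | [] => []
  | .tm (.role R) :: υs => R :: appRoles υs
  | .tm (.rho .rel) :: υs => .nom :: appRoles υs
  | .tm (.rho .irr) :: υs => appRoles υs
  | .co :: υs => appRoles υs

/-- The flags `υs` saturate the relevant parameters declared for `F`. -/
inductive SatApp {K : Type u} (S : Sig K) : K → List AnyFlag → Prop
  | const {F : K} {A : Tm K} {υs : List AnyFlag} :
      (F, Decl.const A (appRoles υs)) ∈ S → SatApp S F υs
  | ax {F : K} {A : Tm K} {p : Pat K} {R : Role} {a : Tm K} {υs : List AnyFlag} :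
      (F, Decl.ax A (appRoles υs) p R a) ∈ S → SatApp S F υs

/-! ## Parallel reduction -/

/-- `Par S Ω a a' R` is `Ω ⊨ a ⇒_R a'`, with respect to the top-level signature `S`. -/
inductive Par {K : Type u} (S : Sig K) : List Role → Tm K → Tm K → Role → Prop
  | refl {Ω : List Role} {a : Tm K} {R : Role} : Roleing S Ω a R → Par S Ω a a R
  | beta {Ω : List Role} {a a' b b' : Tm K} {ρ : Relevance} {R : Role} :
      Par S Ω a (.lam ρ a') R → Par S Ω b b' .nom →
      Par S Ω (.app a (.rho ρ) b) (a'.inst b') R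
  | app {Ω : List Role} {a a' b b' : Tm K} {ν : AppFlag} {R : Role} :
      Par S Ω a a' R → Par S Ω b b' (ν.argRole R) →
      Par S Ω (.app a ν b) (.app a' ν b') R
  | cbeta {Ω : List Role} {a a' : Tm K} {R : Role} :
      Par S Ω a (.clam a') R → Par S Ω (.capp a) a' R
  | capp {Ω : List Role} {a a' : Tm K} {R : Role} :
      Par S Ω a a' R → Par S Ω (.capp a) (.capp a') R
  | lam {Ω : List Role} {b b' : Tm K} {ρ : Relevance} {R : Role} :
      Par S (.nom :: Ω) b b' R → Par S Ω (.lam ρ b) (.lam ρ b') R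
  | pi {Ω : List Role} {A A' B B' : Tm K} {ρ : Relevance} {R : Role} :
      Par S Ω A A' R → Par S (.nom :: Ω) B B' R → Par S Ω (.pi ρ A B) (.pi ρ A' B') R
  | clam {Ω : List Role} {b b' : Tm K} {R : Role} :
      Par S Ω b b' R → Par S Ω (.clam b) (.clam b') R
  | cpi {Ω : List Role} {a a' b b' A A' B B' : Tm K} {R₀ R₁ R : Role} :
      Par S Ω a a' R₁ → Par S Ω b b' R₁ → Par S Ω A A' R₀ → Par S Ω B B' R →
      Par S Ω (.cpi a b A R₁ B) (.cpi a' b' A' R₁ B') R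
  | axiomBase {Ω : List Role} {F : K} {A : Tm K} {Rs : List Role} {R₁ : Role} {b : Tm K}
      {R : Role} :
      (F, Decl.ax A Rs (.fam F) R₁ b) ∈ S → SubRole R₁ R → Par S Ω (.fam F) b R
  | axiomApp {Ω : List Role} {F : K} {A : Tm K} {Rs : List Role} {p : Pat K} {R₁ : Role}
      {b a a' a₁ a₁' a₂ : Tm K} {ν : AppFlag} {R : Role} :
      (F, Decl.ax A Rs p R₁ b) ∈ S → SubRole R₁ R → PatAgree (.app a ν a₁) p →
      Par S Ω a a' R → Par S Ω a₁ a₁' (ν.argRole R) →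
      MatchSubst (.app a' ν a₁') p b a₂ →
      Par S Ω (.app a ν a₁) a₂ R
  | axiomCApp {Ω : List Role} {F : K} {A : Tm K} {Rs : List Role} {p : Pat K} {R₁ : Role}
      {b a a' a₂ : Tm K} {R : Role} :
      (F, Decl.ax A Rs p R₁ b) ∈ S → SubRole R₁ R → PatAgree (.capp a) p →
      Par S Ω a a' R → MatchSubst (.capp a') p b a₂ →
      Par S Ω (.capp a) a₂ R
  | case {Ω : List Role} {a a' b₁ b₁' b₂ b₂' : Tm K} {F : K} {υs : List AnyFlag} {R : Role} :
      Par S Ω a a' .nom → Par S Ω b₁ b₁' R → Par S Ω b₂ b₂' R →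
      Par S Ω (.case a F υs b₁ b₂) (.case a' F υs b₁' b₂') R
  | caseTrue {Ω : List Role} {a a' b₁ b₁' b₂ b₂' b : Tm K} {F : K} {υs : List AnyFlag}
      {R : Role} :
      Par S Ω a a' .nom → Par S Ω b₁ b₁' R → Par S Ω b₂ b₂' R →
      AppsPath S .nom a' F υs → SatApp S F υs → ApplyArgs a' b₁' b →
      Par S Ω (.case a F υs b₁ b₂) (.capp b) R
  | caseFalse {Ω : List Role} {a a' b₁ b₁' b₂ b₂' : Tm K} {F : K} {υs : List AnyFlag}
      {R : Role} :
      Par S Ω a a' .nom → Par S Ω b₁ b₁' R → Par S Ω b₂ b₂' R →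
      Value S .nom a' → ¬ AppsPath S .nom a' F υs →
      Par S Ω (.case a F υs b₁ b₂) b₂' R

end SystemDR

/-!
Parallel reduction has the diamond property. Every premise of a rule for `Par` reduces an
immediate subterm of the source, so the diamond is proved by structural induction on the source,
for all contexts and roles at once: the reducts of each subterm are joined by the induction
hypothesis, and a term built from these joins is a common reduct. The freedom to vary the role is
what handles the annotation `A` in `∀c : (a ∼ b : A). B`, whose two reductions may use different
roles: both are moved to `rep` by `Par.mono`.

Three facts carry the argument.

* Substitution (`Par.subst`): if `σ i ⇒ τ i` at the role of the variable `i`, for every `i`, then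
  `a ⇒ a'` implies `a[σ] ⇒ a'[τ]`. It joins `β`-contracta, and, applied to the right-hand side of
  an axiom, which role-checks in the context of the pattern, it joins contracta of axioms.
* Rigidity of inert paths (`ValuePath.pathRel_of_par`): a path none of whose prefixes can be
  unfolded by the axiom of its head reduces only to paths with the same head and flags, argument
  by argument. Since a constant has at most one axiom, this applies to the function part of an
  instance of a pattern, so such an instance remains one under reduction of its parts; it also
  applies to the scrutinees for which a `case` expression makes its choice.
* Stability of that choice (`AppsPath.par`, `Value.par`): the side conditions of both contraction
  rules for `case` survive reduction of the scrutinee, and exclude each other.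
-/

namespace SystemDR

universe v

variable {K : Type v} {S : Sig K}

/-! ### Substitution -/

namespace Tm

theorem up_var (ξ : ℕ → ℕ) :
    up (fun i => (var (ξ i) : Tm K)) = fun i => var (upRen ξ i) := by
  funext i
  cases i <;> rfl

theorem rename_eq_subst (ξ : ℕ → ℕ) (a : Tm K) :
    rename ξ a = subst (fun i => var (ξ i)) a := by
  induction a generalizing ξ <;> simp_all [rename, subst, up_var]

theorem up_id : up (var : ℕ → Tm K) = var := by
  funext i
  cases i <;> rfl

theorem subst_var (a : Tm K) : subst var a = a := by
  induction a <;> simp_all [subst, up_id]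

theorem up_comp_upRen (σ : ℕ → Tm K) (ξ : ℕ → ℕ) :
    (fun i => up σ (upRen ξ i)) = up (fun i => σ (ξ i)) := by
  funext i
  cases i <;> rfl

theorem subst_rename (σ : ℕ → Tm K) (ξ : ℕ → ℕ) (a : Tm K) :
    subst σ (rename ξ a) = subst (fun i => σ (ξ i)) a := by
  induction a generalizing σ ξ <;> simp_all [rename, subst, up_comp_upRen]

theorem rename_rename (ξ ζ : ℕ → ℕ) (a : Tm K) :
    rename ζ (rename ξ a) = rename (fun i => ζ (ξ i)) a := by
  rw [rename_eq_subst ζ, subst_rename, rename_eq_subst]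

theorem rename_up (σ : ℕ → Tm K) (ξ : ℕ → ℕ) :
    (fun i => rename (upRen ξ) (up σ i)) = up (fun i => rename ξ (σ i)) := by
  funext i
  cases i with
  | zero => rfl
  | succ i => simp [up, rename_rename, upRen]

theorem rename_subst (σ : ℕ → Tm K) (ξ : ℕ → ℕ) (a : Tm K) :
    rename ξ (subst σ a) = subst (fun i => rename ξ (σ i)) a := by
  induction a generalizing σ ξ <;> simp_all [rename, subst, rename_up]

theorem subst_up (σ τ : ℕ → Tm K) :
    (fun i => subst (up τ) (up σ i)) = up (fun i => subst τ (σ i)) := by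
  funext i
  cases i with
  | zero => rfl
  | succ i => simp [up, subst_rename, rename_subst]

theorem subst_subst (σ τ : ℕ → Tm K) (a : Tm K) :
    subst τ (subst σ a) = subst (fun i => subst τ (σ i)) a := by
  induction a generalizing σ τ <;> simp_all [subst, subst_up]

theorem inst_subst (σ : ℕ → Tm K) (a b : Tm K) :
    (a.inst b).subst σ = (a.subst (up σ)).inst (b.subst σ) := by
  simp only [inst, subst_subst]
  congr 1
  funext i
  cases i with
  | zero => rfl
  | succ i => simp [ofList, up, subst_rename, subst, subst_var]

theorem ofList_map (σ : ℕ → Tm K) (as : List (Tm K)) {i : ℕ} (hi : i < as.length) :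
    ofList (as.map (subst σ)) i = (ofList as i).subst σ := by
  induction as generalizing i with
  | nil => simp at hi
  | cons a as ih =>
    cases i with
    | zero => rfl
    | succ i => exact ih (by simpa using hi)

end Tm

/-! ### Roles and role-checking -/

theorem SubRole.meet_mono {R R' : Role} (h : SubRole R R') (R₁ : Role) :
    SubRole (R₁.meet R) (R₁.meet R') := by
  cases R₁ with
  | nom => exact .nomBot _
  | rep => cases R <;> cases R' <;> exact h

theorem Role.meet_le_left (R₁ R : Role) : SubRole (R₁.meet R) R₁ := by
  cases R₁ <;> cases R <;> constructor

theorem AppFlag.argRole_mono {R R' : Role} (h : SubRole R R') (ν : AppFlag) :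
    SubRole (ν.argRole R) (ν.argRole R') := by
  cases ν with
  | role R₁ => exact h.meet_mono R₁
  | rho => exact .refl _

theorem AppFlag.argRole_nom (ν : AppFlag) : ν.argRole .nom = .nom := by
  rcases ν with (_ | _) | _ <;> rfl

theorem roleing_app_iff {Ω : List Role} {a b : Tm K} {ν : AppFlag} {R : Role} :
    Roleing S Ω (.app a ν b) R ↔ Roleing S Ω a R ∧ Roleing S Ω b (ν.argRole R) := by
  constructor
  · intro h
    cases h with
    | app h₁ h₂ => exact ⟨h₁, h₂⟩
    | tapp h₁ h₂ => exact ⟨h₁, h₂⟩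
  · rintro ⟨h₁, h₂⟩
    cases ν with
    | role R₁ => exact .tapp h₁ h₂
    | rho => exact .app h₁ h₂

theorem Roleing.mono {Ω : List Role} {a : Tm K} {R R' : Role} (h : Roleing S Ω a R)
    (hR : SubRole R R') : Roleing S Ω a R' := by
  induction h generalizing R' with
  | star => exact .star
  | box => exact .box
  | var h₁ h₂ => exact .var h₁ (h₂.trans hR)
  | const h => exact .const h
  | ax h => exact .ax h
  | lam _ ih => exact .lam (ih hR)
  | app _ hb iha _ => exact .app (iha hR) hb
  | tapp _ _ iha ihb => exact .tapp (iha hR) (ihb (hR.meet_mono _))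
  | pi _ _ iha ihb => exact .pi (iha hR) (ihb hR)
  | cpi ha hb hA _ _ _ _ ihB => exact .cpi ha hb hA (ihB hR)
  | clam _ ih => exact .clam (ih hR)
  | capp _ ih => exact .capp (ih hR)
  | case ha _ _ _ ih₁ ih₂ => exact .case ha (ih₁ hR) (ih₂ hR)

/-- A term that role-checks in `Ω` has no free variables beyond those of `Ω`. -/
theorem Roleing.subst_congr {Ω : List Role} {a : Tm K} {R : Role} (h : Roleing S Ω a R)
    {σ τ : ℕ → Tm K} (hστ : ∀ i < Ω.length, σ i = τ i) : a.subst σ = a.subst τ := by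
  have hup {Ω : List Role} {σ τ : ℕ → Tm K} (hστ : ∀ i < Ω.length, σ i = τ i) :
      ∀ i < (Role.nom :: Ω).length, Tm.up σ i = Tm.up τ i := by
    intro i hi
    cases i with
    | zero => rfl
    | succ i => simp [Tm.up, hστ i (by simpa using hi)]
  induction h generalizing σ τ with
  | star | box | const | ax => rfl
  | var h₁ _ => exact hστ _ (List.getElem?_eq_some_iff.1 h₁).1
  | lam _ ih => simp [Tm.subst, ih (hup hστ)]
  | app _ _ iha ihb => simp [Tm.subst, iha hστ, ihb hστ]
  | tapp _ _ iha ihb => simp [Tm.subst, iha hστ, ihb hστ]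
  | pi _ _ iha ihb => simp [Tm.subst, iha hστ, ihb (hup hστ)]
  | cpi _ _ _ _ iha ihb ihA ihB => simp [Tm.subst, iha hστ, ihb hστ, ihA hστ, ihB hστ]
  | clam _ ih => simp [Tm.subst, ih hστ]
  | capp _ ih => simp [Tm.subst, ih hστ]
  | case _ _ _ ih ih₁ ih₂ => simp [Tm.subst, ih hστ, ih₁ hστ, ih₂ hστ]

/-- Role-checking is stable under any class `P` of substitutions that is closed under binders and
respects roles. Instantiating `P` with renamings, and then with all substitutions that respect
roles, avoids a separate induction for renamings. -/
theorem Roleing.subst_of {P : List Role → List Role → (ℕ → Tm K) → Prop}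
    (hvar : ∀ {Ω Δ σ i R}, P Ω Δ σ → (Ω)[i]? = some R → Roleing S Δ (σ i) R)
    (hup : ∀ {Ω Δ σ}, P Ω Δ σ → P (.nom :: Ω) (.nom :: Δ) (Tm.up σ))
    {Ω Δ : List Role} {a : Tm K} {R : Role} {σ : ℕ → Tm K}
    (h : Roleing S Ω a R) (hσ : P Ω Δ σ) : Roleing S Δ (a.subst σ) R := by
  induction h generalizing Δ σ with
  | star => exact .star
  | box => exact .box
  | var h₁ h₂ => exact (hvar hσ h₁).mono h₂
  | const h => exact .const h
  | ax h => exact .ax h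
  | lam _ ih => exact .lam (ih (hup hσ))
  | app _ _ iha ihb => exact .app (iha hσ) (ihb hσ)
  | tapp _ _ iha ihb => exact .tapp (iha hσ) (ihb hσ)
  | pi _ _ iha ihb => exact .pi (iha hσ) (ihb (hup hσ))
  | cpi _ _ _ _ iha ihb ihA ihB => exact .cpi (iha hσ) (ihb hσ) (ihA hσ) (ihB hσ)
  | clam _ ih => exact .clam (ih hσ)
  | capp _ ih => exact .capp (ih hσ)
  | case _ _ _ ih ih₁ ih₂ => exact .case (ih hσ) (ih₁ hσ) (ih₂ hσ)

/-- `σ` is a renaming of the variables of `Ω` to variables of `Δ` with the same roles. -/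
def IsRen (Ω Δ : List Role) (σ : ℕ → Tm K) : Prop :=
  ∃ ξ : ℕ → ℕ, σ = (fun i => .var (ξ i)) ∧
    ∀ {i : ℕ} {R : Role}, (Ω)[i]? = some R → (Δ)[ξ i]? = some R

theorem IsRen.up {Ω Δ : List Role} {σ : ℕ → Tm K} (h : IsRen Ω Δ σ) (R : Role) :
    IsRen (R :: Ω) (R :: Δ) (Tm.up σ) := by
  obtain ⟨ξ, rfl, hξ⟩ := h
  refine ⟨Tm.upRen ξ, Tm.up_var ξ, fun {i _} hi => ?_⟩
  cases i with
  | zero => exact hi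
  | succ i => exact hξ hi

theorem isRen_succ (Ω : List Role) (R : Role) :
    IsRen Ω (R :: Ω) (fun i => (.var i.succ : Tm K)) :=
  ⟨Nat.succ, rfl, fun h => h⟩

theorem IsRen.roleing {Ω Δ : List Role} {σ : ℕ → Tm K} {i : ℕ} {R : Role} (h : IsRen Ω Δ σ)
    (hi : (Ω)[i]? = some R) : Roleing S Δ (σ i) R := by
  obtain ⟨ξ, rfl, hξ⟩ := h
  exact .var (hξ hi) (.refl _)

theorem Roleing.weaken {Ω : List Role} {a : Tm K} {R : Role} (h : Roleing S Ω a R) (R₁ : Role) :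
    Roleing S (R₁ :: Ω) (a.rename Nat.succ) R := by
  rw [Tm.rename_eq_subst]
  exact h.subst_of IsRen.roleing (fun h => h.up _) (isRen_succ Ω R₁)

theorem Roleing.subst {Ω Δ : List Role} {a : Tm K} {R : Role} {σ : ℕ → Tm K}
    (h : Roleing S Ω a R) (hσ : ∀ {i R}, (Ω)[i]? = some R → Roleing S Δ (σ i) R) :
    Roleing S Δ (a.subst σ) R := by
  refine h.subst_of (P := fun Ω Δ σ => ∀ i R, (Ω)[i]? = some R → Roleing S Δ (σ i) R)
    (fun h => h _ _) (fun hσ i R hi => ?_) (fun _ _ => hσ)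
  cases i with
  | zero => exact .var hi (.refl _)
  | succ i => exact (hσ i R hi).weaken _

theorem Roleing.inst {Ω : List Role} {a b : Tm K} {R R₁ : Role} (ha : Roleing S (R₁ :: Ω) a R)
    (hb : Roleing S Ω b R₁) : Roleing S Ω (a.inst b) R := by
  refine ha.subst fun {i _} hi => ?_
  cases i with
  | zero =>
    cases hi
    exact hb
  | succ i => exact .var hi (.refl _)

/-! ### Signatures -/

theorem SigOk.axiom_ok {S₀ : Sig K} (h : SigOk S₀ S) {F : K} {A : Tm K} {Rs : List Role}
    {p : Pat K} {R : Role} {b : Tm K} (hF : (F, Decl.ax A Rs p R b) ∈ S) :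
    p.head = F ∧ Roleing S₀ p.ctx b R := by
  induction h with
  | empty => simp at hF
  | consConst _ _ ih => exact ih (by simpa using hF)
  | consAx _ _ hp _ hb ih =>
    rcases List.mem_cons.1 hF with h | h
    · cases h
      exact ⟨hp, hb⟩
    · exact ih h

theorem SigOk.unique {S₀ : Sig K} (h : SigOk S₀ S) {F : K} {d d' : Decl K}
    (hd : (F, d) ∈ S) (hd' : (F, d') ∈ S) : d = d' := by
  have key {S : Sig K} {G : K} {e : Decl K} (hG : G ∉ S.map Prod.fst)
      (ih : (F, d) ∈ S → (F, d') ∈ S → d = d') (h₁ : (F, d) ∈ (G, e) :: S)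
      (h₂ : (F, d') ∈ (G, e) :: S) : d = d' := by
    rw [List.mem_cons] at h₁ h₂
    rcases h₁ with h₁ | h₁ <;> rcases h₂ with h₂ | h₂
    · cases h₁
      cases h₂
      rfl
    · cases h₁
      exact absurd (List.mem_map.2 ⟨_, h₂, rfl⟩) hG
    · cases h₂
      exact absurd (List.mem_map.2 ⟨_, h₁, rfl⟩) hG
    · exact ih h₁ h₂
  induction h with
  | empty => simp at hd
  | consConst _ hG ih => exact key hG ih hd hd'
  | consAx _ hG _ _ _ ih => exact key hG ih hd hd'

/-! ### Paths of the same shape -/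

/-- `PathRel r a a'`: `a` and `a'` are paths with the same head and the same argument flags, whose
arguments are related by `r`. As in all paths, irrelevant arguments are `□`. -/
inductive PathRel (r : AppFlag → Tm K → Tm K → Prop) : Tm K → Tm K → Prop
  | fam (F : K) : PathRel r (.fam F) (.fam F)
  | app {a a' b b' : Tm K} {ν : AppFlag} : PathRel r a a' →
      (ν = .rho .irr → b = .box ∧ b' = .box) → r ν b b' → PathRel r (.app a ν b) (.app a' ν b')
  | capp {a a' : Tm K} : PathRel r a a' → PathRel r (.capp a) (.capp a')

/-- `a` and `a'` are paths with the same head and the same argument flags. -/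
abbrev SameShape : Tm K → Tm K → Prop := PathRel fun _ _ _ => True

theorem PathRel.sameShape {r : AppFlag → Tm K → Tm K → Prop} {a a' : Tm K}
    (h : PathRel r a a') : SameShape a a' := by
  induction h with
  | fam F => exact .fam F
  | app _ h _ ih => exact .app ih h trivial
  | capp _ ih => exact .capp ih

theorem SameShape.symm {a a' : Tm K} (h : SameShape a a') : SameShape a' a := by
  induction h with
  | fam F => exact .fam F
  | app _ h _ ih => exact .app ih (fun e => (h e).symm) trivial
  | capp _ ih => exact .capp ih

theorem valuePath_app_iff {a b : Tm K} {ν : AppFlag} {F : K} :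
    ValuePath S (.app a ν b) F ↔ ValuePath S a F ∧ (ν = .rho .irr → b = .box) := by
  constructor
  · intro h
    cases h <;> simp_all
  · rintro ⟨h, hb⟩
    rcases ν with R | _ | _
    · exact .appRole h
    · exact .appRel h
    · rw [hb rfl]
      exact .appIrr h

theorem SameShape.valuePath {a a' : Tm K} {F : K} (h : SameShape a a') (ha : ValuePath S a F) :
    ValuePath S a' F := by
  induction h with
  | fam => exact ha
  | app _ hb _ ih =>
    rw [valuePath_app_iff] at ha ⊢
    exact ⟨ih ha.1, fun e => (hb e).2⟩
  | capp _ ih =>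
    cases ha with
    | capp ha => exact .capp (ih ha)

theorem SameShape.patAgree {a a' : Tm K} {p : Pat K} (h : SameShape a a') (ha : PatAgree a p) :
    PatAgree a' p := by
  obtain ⟨as, ha⟩ := ha
  induction ha generalizing a' with
  | fam =>
    cases h
    exact ⟨_, .fam⟩
  | appRole _ ih =>
    cases h with
    | app h _ _ =>
      obtain ⟨as, ha⟩ := ih h
      exact ⟨_, .appRole ha⟩
  | appRel _ ih =>
    cases h with
    | app h _ _ =>
      obtain ⟨as, ha⟩ := ih h
      exact ⟨_, .appRel ha⟩
  | appIrr _ ih =>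
    cases h with
    | app h hb _ =>
      obtain ⟨as, ha⟩ := ih h
      rw [(hb rfl).2]
      exact ⟨_, .appIrr ha⟩
  | capp _ ih =>
    cases h with
    | capp h =>
      obtain ⟨as, ha⟩ := ih h
      exact ⟨_, .capp ha⟩

theorem SameShape.prefixAgree {a a' : Tm K} {p : Pat K} (h : SameShape a a')
    (ha : PrefixAgree a p) : PrefixAgree a' p := by
  induction ha generalizing a' with
  | base ha => exact .base (h.patAgree ha)
  | app _ ih =>
    cases h with
    | app h _ _ => exact .app (ih h)
  | capp _ ih =>
    cases h with
    | capp h => exact .capp (ih h)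

theorem SameShape.appsPath {a a' : Tm K} {F : K} {υs : List AnyFlag} {R : Role}
    (h : SameShape a a') (ha : AppsPath S R a F υs) : AppsPath S R a' F υs := by
  induction ha generalizing a' with
  | absConst hF =>
    cases h
    exact .absConst hF
  | const hF hR =>
    cases h
    exact .const hF hR
  | appRole _ ih =>
    cases h with
    | app h _ _ => exact .appRole (ih h)
  | appRel _ ih =>
    cases h with
    | app h _ _ => exact .appRel (ih h)
  | appIrr _ ih =>
    cases h with
    | app h hb _ =>
      rw [(hb rfl).2]
      exact .appIrr (ih h)
  | capp _ ih =>
    cases h with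
    | capp h => exact .capp (ih h)

theorem SameShape.casePath {a a' : Tm K} {F : K} {R : Role} (h : SameShape a a')
    (ha : CasePath S R a F) : CasePath S R a' F := by
  cases ha with
  | absConst hv hF => exact .absConst (h.valuePath hv) hF
  | const hv hF hR => exact .const (h.valuePath hv) hF hR
  | unMatch hv hF hp => exact .unMatch (h.valuePath hv) hF fun hp' => hp (h.symm.prefixAgree hp')

theorem ValuePath.sameShape_subst {a : Tm K} {F : K} (h : ValuePath S a F) (σ : ℕ → Tm K) :
    SameShape a (a.subst σ) := by
  induction h with
  | const => exact .fam _
  | appRole _ ih => exact .app ih (by simp) trivial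
  | appRel _ ih => exact .app ih (by simp) trivial
  | appIrr _ ih => exact .app ih (fun _ => ⟨rfl, rfl⟩) trivial
  | capp _ ih => exact .capp ih

theorem AppsPath.valuePath {a : Tm K} {F : K} {υs : List AnyFlag} {R : Role}
    (h : AppsPath S R a F υs) : ValuePath S a F := by
  induction h with
  | absConst hF => exact .const hF
  | const hF _ => exact .const hF
  | appRole _ ih => exact .appRole ih
  | appRel _ ih => exact .appRel ih
  | appIrr _ ih => exact .appIrr ih
  | capp _ ih => exact .capp ih

theorem CasePath.valuePath {a : Tm K} {F : K} {R : Role} (h : CasePath S R a F) :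
    ValuePath S a F := by
  cases h <;> assumption

theorem AppsPath.subst {a : Tm K} {F : K} {υs : List AnyFlag} {R : Role}
    (h : AppsPath S R a F υs) (σ : ℕ → Tm K) : AppsPath S R (a.subst σ) F υs :=
  (h.valuePath.sameShape_subst σ).appsPath h

/-- Substitution maps values to values and does not turn a value into a path of a new shape. -/
theorem Value.subst {a : Tm K} {R : Role} (h : Value S R a) (σ : ℕ → Tm K) :
    Value S R (a.subst σ) ∧
      ∀ {F : K} {υs : List AnyFlag}, AppsPath S R (a.subst σ) F υs → AppsPath S R a F υs := by
  induction h generalizing σ with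
  | star => exact ⟨.star, fun h => by cases h⟩
  | pi => exact ⟨.pi, fun h => by cases h⟩
  | cpi => exact ⟨.cpi, fun h => by cases h⟩
  | lamRel => exact ⟨.lamRel, fun h => by cases h⟩
  | lamIrr _ ih => exact ⟨.lamIrr (ih _).1, fun h => by cases h⟩
  | clam => exact ⟨.clam, fun h => by cases h⟩
  | path h =>
    have hs := h.valuePath.sameShape_subst σ
    exact ⟨.path (hs.casePath h), hs.symm.appsPath⟩

/-! ### Matching -/

theorem Match.length_eq {a : Tm K} {p : Pat K} {as : List (Tm K)} (h : Match a p as) :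
    as.length = p.ctx.length := by
  induction h <;> simp_all [Pat.ctx]

theorem Match.subst {a : Tm K} {p : Pat K} {as : List (Tm K)} (h : Match a p as)
    (σ : ℕ → Tm K) : Match (a.subst σ) p (as.map (Tm.subst σ)) := by
  induction h with
  | fam => exact .fam
  | appRole _ ih => exact .appRole ih
  | appRel _ ih => exact .appRel ih
  | appIrr _ ih => exact .appIrr ih
  | capp _ ih => exact .capp ih

theorem PatAgree.subst {a : Tm K} {p : Pat K} (h : PatAgree a p) (σ : ℕ → Tm K) :
    PatAgree (a.subst σ) p :=
  let ⟨_, h⟩ := h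
  ⟨_, h.subst σ⟩

theorem MatchSubst.subst {a b c : Tm K} {p : Pat K} {R : Role} (h : MatchSubst a p b c)
    (hb : Roleing S p.ctx b R) (σ : ℕ → Tm K) : MatchSubst (a.subst σ) p b (c.subst σ) := by
  obtain ⟨as, hm, rfl⟩ := h
  refine ⟨_, hm.subst σ, ?_⟩
  rw [Tm.subst_subst]
  exact hb.subst_congr fun i hi => (Tm.ofList_map σ as (hm.length_eq ▸ hi)).symm

theorem Match.unique {a : Tm K} {p q : Pat K} {as bs : List (Tm K)} (h : Match a p as)
    (h' : Match a q bs) : p = q ∧ as = bs := by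
  induction h generalizing q bs with
  | fam =>
    cases h'
    exact ⟨rfl, rfl⟩
  | appRole _ ih | appRel _ ih | appIrr _ ih | capp _ ih =>
    cases h'
    obtain ⟨rfl, rfl⟩ := ih ‹_›
    exact ⟨rfl, rfl⟩

theorem Match.head_eq {a : Tm K} {p : Pat K} {as : List (Tm K)} {F : K} (h : Match a p as)
    (ha : ValuePath S a F) : p.head = F := by
  induction h with
  | fam =>
    cases ha
    rfl
  | appRole _ ih | appRel _ ih | appIrr _ ih | capp _ ih =>
    cases ha
    exact ih ‹_›

theorem Match.valuePath {a : Tm K} {p : Pat K} {as : List (Tm K)} {d : Decl K}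
    (h : Match a p as) (hd : (p.head, d) ∈ S) : ValuePath S a p.head := by
  induction h with
  | fam => exact .const hd
  | appRole _ ih => exact .appRole (ih hd)
  | appRel _ ih => exact .appRel (ih hd)
  | appIrr _ ih => exact .appIrr (ih hd)
  | capp _ ih => exact .capp (ih hd)

/-- In a term that role-checks, the term matched by a pattern variable has the role of that
variable. -/
theorem Match.roleing {Ω : List Role} {a : Tm K} {p : Pat K} {as : List (Tm K)} {R : Role}
    (h : Match a p as) (ha : Roleing S Ω a R) {i : ℕ} {R₁ : Role} (hi : p.ctx[i]? = some R₁) :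
    Roleing S Ω (Tm.ofList as i) R₁ := by
  induction h generalizing i with
  | fam => simp [Pat.ctx] at hi
  | appRole _ ih =>
    rw [roleing_app_iff] at ha
    cases i with
    | zero =>
      cases hi
      exact ha.2.mono (Role.meet_le_left _ _)
    | succ i => exact ih ha.1 hi
  | appRel _ ih =>
    rw [roleing_app_iff] at ha
    cases i with
    | zero =>
      cases hi
      exact ha.2
    | succ i => exact ih ha.1 hi
  | appIrr _ ih => exact ih (roleing_app_iff.1 ha).1 hi
  | capp _ ih =>
    cases ha with
    | capp ha => exact ih ha hi

/-- Prefixes of an instance of `q` agree only with patterns no larger than `q`. Hence the pattern of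
an axiom agrees with no prefix of an instance of a smaller pattern. -/
theorem PrefixAgree.sizeOf_le {a : Tm K} {p q : Pat K} {as : List (Tm K)} (h : PrefixAgree a p)
    (hq : Match a q as) : sizeOf p ≤ sizeOf q := by
  induction h generalizing q as with
  | base h =>
    obtain ⟨_, h⟩ := h
    rw [(h.unique hq).1]
  | app _ ih =>
    cases hq
    all_goals
      have := ih ‹_›
      simp
      omega
  | capp _ ih =>
    cases hq
    all_goals
      have := ih ‹_›
      simp
      omega

/-! ### Passing on the arguments of a path -/

theorem AppsPath.exists_applyArgs {a : Tm K} {F : K} {υs : List AnyFlag} {R : Role}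
    (h : AppsPath S R a F υs) (b : Tm K) : ∃ c, ApplyArgs a b c := by
  induction h with
  | absConst | const => exact ⟨_, .const⟩
  | appRole _ ih =>
    obtain ⟨_, h⟩ := ih
    exact ⟨_, .appRole h⟩
  | appRel _ ih | appIrr _ ih =>
    obtain ⟨_, h⟩ := ih
    exact ⟨_, .appRho h⟩
  | capp _ ih =>
    obtain ⟨_, h⟩ := ih
    exact ⟨_, .capp h⟩

theorem ApplyArgs.subst {a b c : Tm K} (h : ApplyArgs a b c) (σ : ℕ → Tm K) :
    ApplyArgs (a.subst σ) (b.subst σ) (c.subst σ) := by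
  induction h with
  | const => exact .const
  | appRole _ ih => exact .appRole ih
  | appRho _ ih => exact .appRho ih
  | capp _ ih => exact .capp ih

theorem ApplyArgs.roleing {Ω : List Role} {a b c : Tm K} {R : Role} (h : ApplyArgs a b c)
    (ha : Roleing S Ω a .nom) (hb : Roleing S Ω b R) : Roleing S Ω c R := by
  induction h with
  | const => exact hb
  | appRole _ ih | appRho _ ih =>
    rw [roleing_app_iff, AppFlag.argRole_nom] at ha
    exact .app (ih ha.1 hb) ha.2
  | capp _ ih =>
    cases ha with
    | capp ha => exact .capp (ih ha hb)

/-! ### Parallel reduction: roles and substitution -/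

theorem Par.mono {Ω : List Role} {a a' : Tm K} {R R' : Role} (h : Par S Ω a a' R)
    (hR : SubRole R R') : Par S Ω a a' R' := by
  induction h generalizing R' with
  | refl h => exact .refl (h.mono hR)
  | beta _ hb ih _ => exact .beta (ih hR) hb
  | app _ _ iha ihb => exact .app (iha hR) (ihb (AppFlag.argRole_mono hR _))
  | cbeta _ ih => exact .cbeta (ih hR)
  | capp _ ih => exact .capp (ih hR)
  | lam _ ih => exact .lam (ih hR)
  | pi _ _ iha ihb => exact .pi (iha hR) (ihb hR)
  | clam _ ih => exact .clam (ih hR)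
  | cpi ha hb hA _ _ _ _ ihB => exact .cpi ha hb hA (ihB hR)
  | axiomBase hF h => exact .axiomBase hF (h.trans hR)
  | axiomApp hF h hp _ _ hm iha ihb =>
    exact .axiomApp hF (h.trans hR) hp (iha hR) (ihb (AppFlag.argRole_mono hR _)) hm
  | axiomCApp hF h hp _ hm iha => exact .axiomCApp hF (h.trans hR) hp (iha hR) hm
  | case ha _ _ _ ih₁ ih₂ => exact .case ha (ih₁ hR) (ih₂ hR)
  | caseTrue ha _ _ hp hs hb _ ih₁ ih₂ => exact .caseTrue ha (ih₁ hR) (ih₂ hR) hp hs hb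
  | caseFalse ha _ _ hv hn _ ih₁ ih₂ => exact .caseFalse ha (ih₁ hR) (ih₂ hR) hv hn

theorem Par.roleing_left {Ω : List Role} {a a' : Tm K} {R : Role} (h : Par S Ω a a' R) :
    Roleing S Ω a R := by
  induction h with
  | refl h => exact h
  | beta _ _ iha ihb => exact .app iha ihb
  | app _ _ iha ihb => exact roleing_app_iff.2 ⟨iha, ihb⟩
  | cbeta _ ih => exact .capp ih
  | capp _ ih => exact .capp ih
  | lam _ ih => exact .lam ih
  | pi _ _ iha ihb => exact .pi iha ihb
  | clam _ ih => exact .clam ih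
  | cpi _ _ _ _ iha ihb ihA ihB => exact .cpi iha ihb ihA ihB
  | axiomBase hF _ => exact .ax hF
  | axiomApp _ _ _ _ _ _ iha ihb => exact roleing_app_iff.2 ⟨iha, ihb⟩
  | axiomCApp _ _ _ _ _ ih => exact .capp ih
  | case _ _ _ ih ih₁ ih₂ => exact .case ih ih₁ ih₂
  | caseTrue _ _ _ _ _ _ ih ih₁ ih₂ => exact .case ih ih₁ ih₂
  | caseFalse _ _ _ _ _ ih ih₁ ih₂ => exact .case ih ih₁ ih₂

theorem MatchSubst.roleing (hS : SigOk S S) {Ω : List Role} {F : K} {A : Tm K} {Rs : List Role}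
    {p : Pat K} {R₁ R : Role} {a b c : Tm K} (h : MatchSubst a p b c)
    (hF : (F, Decl.ax A Rs p R₁ b) ∈ S) (hR : SubRole R₁ R) (ha : Roleing S Ω a R) :
    Roleing S Ω c R := by
  obtain ⟨as, hm, rfl⟩ := h
  exact ((hS.axiom_ok hF).2.subst (hm.roleing ha)).mono hR

theorem Par.roleing_right (hS : SigOk S S) {Ω : List Role} {a a' : Tm K} {R : Role}
    (h : Par S Ω a a' R) : Roleing S Ω a' R := by
  induction h with
  | refl h => exact h
  | beta _ _ iha ihb =>
    cases iha with
    | lam iha => exact iha.inst ihb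
  | app _ _ iha ihb => exact roleing_app_iff.2 ⟨iha, ihb⟩
  | cbeta _ ih =>
    cases ih with
    | clam ih => exact ih
  | capp _ ih => exact .capp ih
  | lam _ ih => exact .lam ih
  | pi _ _ iha ihb => exact .pi iha ihb
  | clam _ ih => exact .clam ih
  | cpi _ _ _ _ iha ihb ihA ihB => exact .cpi iha ihb ihA ihB
  | axiomBase hF hR =>
    -- The instance of the pattern `F` is `F` itself, with the identity as its substitution.
    exact MatchSubst.roleing hS ⟨[], .fam, (Tm.subst_var _).symm⟩ hF hR (.ax hF)
  | axiomApp hF hR _ _ _ hm iha ihb => exact hm.roleing hS hF hR (roleing_app_iff.2 ⟨iha, ihb⟩)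
  | axiomCApp hF hR _ _ hm ih => exact hm.roleing hS hF hR (.capp ih)
  | case _ _ _ ih ih₁ ih₂ => exact .case ih ih₁ ih₂
  | caseTrue _ _ _ _ _ hb ih ih₁ _ => exact .capp (hb.roleing ih ih₁)
  | caseFalse _ _ _ _ _ _ _ ih₂ => exact ih₂

/-- A term that role-checks reduces along with the terms substituted into it. As for
`Roleing.subst_of`, the class `P` of pairs of substitutions covers both renamings and the general
case. -/
theorem Roleing.par_subst_of {P : List Role → List Role → (ℕ → Tm K) → (ℕ → Tm K) → Prop}
    (hvar : ∀ {Ω Δ σ τ i R}, P Ω Δ σ τ → (Ω)[i]? = some R → Par S Δ (σ i) (τ i) R)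
    (hup : ∀ {Ω Δ σ τ}, P Ω Δ σ τ → P (.nom :: Ω) (.nom :: Δ) (Tm.up σ) (Tm.up τ))
    {Ω Δ : List Role} {a : Tm K} {R : Role} {σ τ : ℕ → Tm K}
    (h : Roleing S Ω a R) (hσ : P Ω Δ σ τ) : Par S Δ (a.subst σ) (a.subst τ) R := by
  induction h generalizing Δ σ τ with
  | star => exact .refl .star
  | box => exact .refl .box
  | var h₁ h₂ => exact (hvar hσ h₁).mono h₂
  | const h => exact .refl (.const h)
  | ax h => exact .refl (.ax h)
  | lam _ ih => exact .lam (ih (hup hσ))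
  | app _ _ iha ihb => exact .app (iha hσ) (ihb hσ)
  | tapp _ _ iha ihb => exact .app (iha hσ) (ihb hσ)
  | pi _ _ iha ihb => exact .pi (iha hσ) (ihb (hup hσ))
  | cpi _ _ _ _ iha ihb ihA ihB => exact .cpi (iha hσ) (ihb hσ) (ihA hσ) (ihB hσ)
  | clam _ ih => exact .clam (ih hσ)
  | capp _ ih => exact .capp (ih hσ)
  | case _ _ _ ih ih₁ ih₂ => exact .case (ih hσ) (ih₁ hσ) (ih₂ hσ)

theorem Par.subst_of (hS : SigOk S S)
    {P : List Role → List Role → (ℕ → Tm K) → (ℕ → Tm K) → Prop}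
    (hvar : ∀ {Ω Δ σ τ i R}, P Ω Δ σ τ → (Ω)[i]? = some R → Par S Δ (σ i) (τ i) R)
    (hup : ∀ {Ω Δ σ τ}, P Ω Δ σ τ → P (.nom :: Ω) (.nom :: Δ) (Tm.up σ) (Tm.up τ))
    {Ω Δ : List Role} {a a' : Tm K} {R : Role} {σ τ : ℕ → Tm K}
    (h : Par S Ω a a' R) (hσ : P Ω Δ σ τ) : Par S Δ (a.subst σ) (a'.subst τ) R := by
  induction h generalizing Δ σ τ with
  | refl h => exact h.par_subst_of hvar hup hσ
  | beta _ _ iha ihb =>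
    rw [Tm.inst_subst]
    exact .beta (iha hσ) (ihb hσ)
  | app _ _ iha ihb => exact .app (iha hσ) (ihb hσ)
  | cbeta _ ih => exact .cbeta (ih hσ)
  | capp _ ih => exact .capp (ih hσ)
  | lam _ ih => exact .lam (ih (hup hσ))
  | pi _ _ iha ihb => exact .pi (iha hσ) (ihb (hup hσ))
  | clam _ ih => exact .clam (ih hσ)
  | cpi _ _ _ _ iha ihb ihA ihB => exact .cpi (iha hσ) (ihb hσ) (ihA hσ) (ihB hσ)
  | axiomBase hF hR =>
    -- The right-hand side of an axiom without pattern variables is closed.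
    rw [(hS.axiom_ok hF).2.subst_congr (τ := Tm.var) (by simp [Pat.ctx]), Tm.subst_var]
    exact .axiomBase hF hR
  | axiomApp hF hR hp _ _ hm iha ihb =>
    exact .axiomApp hF hR (hp.subst σ) (iha hσ) (ihb hσ) (hm.subst (hS.axiom_ok hF).2 τ)
  | axiomCApp hF hR hp _ hm ih =>
    exact .axiomCApp hF hR (hp.subst σ) (ih hσ) (hm.subst (hS.axiom_ok hF).2 τ)
  | case _ _ _ ih ih₁ ih₂ => exact .case (ih hσ) (ih₁ hσ) (ih₂ hσ)
  | caseTrue _ _ _ hp hs hb ih ih₁ ih₂ =>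
    exact .caseTrue (ih hσ) (ih₁ hσ) (ih₂ hσ) (hp.subst τ) hs (hb.subst τ)
  | caseFalse _ _ _ hv hn ih ih₁ ih₂ =>
    exact .caseFalse (ih hσ) (ih₁ hσ) (ih₂ hσ) (hv.subst τ).1 fun h => hn ((hv.subst τ).2 h)

theorem Par.weaken (hS : SigOk S S) {Ω : List Role} {a a' : Tm K} {R : Role}
    (h : Par S Ω a a' R) (R₁ : Role) :
    Par S (R₁ :: Ω) (a.rename Nat.succ) (a'.rename Nat.succ) R := by
  simp only [Tm.rename_eq_subst]
  refine h.subst_of hS (P := fun Ω Δ σ τ => σ = τ ∧ IsRen Ω Δ σ) ?_ ?_ ⟨rfl, isRen_succ Ω R₁⟩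
  · rintro Ω Δ σ _ i R ⟨rfl, h⟩ hi
    exact .refl (h.roleing hi)
  · rintro Ω Δ σ _ ⟨rfl, h⟩
    exact ⟨rfl, h.up _⟩

/-- Parallel reduction is compatible with parallel reduction of the terms substituted for the
variables, each at the role of its variable. -/
theorem Par.subst (hS : SigOk S S) {Ω Δ : List Role} {a a' : Tm K} {R : Role} {σ τ : ℕ → Tm K}
    (h : Par S Ω a a' R) (hσ : ∀ {i R}, (Ω)[i]? = some R → Par S Δ (σ i) (τ i) R) :
    Par S Δ (a.subst σ) (a'.subst τ) R := by
  refine h.subst_of hS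
    (P := fun Ω Δ σ τ => ∀ i R, (Ω)[i]? = some R → Par S Δ (σ i) (τ i) R)
    (fun h => h _ _) (fun hσ i R hi => ?_) (fun _ _ => hσ)
  cases i with
  | zero => exact .refl (.var hi (.refl _))
  | succ i => exact (hσ i R hi).weaken hS _

theorem Par.inst (hS : SigOk S S) {Ω : List Role} {a a' b b' : Tm K} {R R₁ : Role}
    (ha : Par S (R₁ :: Ω) a a' R) (hb : Par S Ω b b' R₁) :
    Par S Ω (a.inst b) (a'.inst b') R := by
  refine ha.subst hS fun {i _} hi => ?_
  cases i with
  | zero =>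
    cases hi
    exact hb
  | succ i => exact .refl (.var hi (.refl _))

/-! ### Inversion of parallel reduction -/

theorem Par.star_inv {Ω : List Role} {t : Tm K} {R : Role} (h : Par S Ω .star t R) :
    t = .star := by
  cases h
  rfl

theorem Par.box_inv {Ω : List Role} {t : Tm K} {R : Role} (h : Par S Ω .box t R) :
    t = .box := by
  cases h
  rfl

theorem Par.var_inv {Ω : List Role} {i : ℕ} {t : Tm K} {R : Role} (h : Par S Ω (.var i) t R) :
    t = .var i := by
  cases h
  rfl

theorem Par.lam_inv {Ω : List Role} {ρ : Relevance} {b t : Tm K} {R : Role}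
    (h : Par S Ω (.lam ρ b) t R) : ∃ b', t = .lam ρ b' ∧ Par S (.nom :: Ω) b b' R := by
  cases h with
  | refl h =>
    cases h with
    | lam h => exact ⟨_, rfl, .refl h⟩
  | lam h => exact ⟨_, rfl, h⟩

theorem Par.clam_inv {Ω : List Role} {b t : Tm K} {R : Role} (h : Par S Ω (.clam b) t R) :
    ∃ b', t = .clam b' ∧ Par S Ω b b' R := by
  cases h with
  | refl h =>
    cases h with
    | clam h => exact ⟨_, rfl, .refl h⟩
  | clam h => exact ⟨_, rfl, h⟩

theorem Par.pi_inv {Ω : List Role} {ρ : Relevance} {A B t : Tm K} {R : Role}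
    (h : Par S Ω (.pi ρ A B) t R) :
    ∃ A' B', t = .pi ρ A' B' ∧ Par S Ω A A' R ∧ Par S (.nom :: Ω) B B' R := by
  cases h with
  | refl h =>
    cases h with
    | pi hA hB => exact ⟨_, _, rfl, .refl hA, .refl hB⟩
  | pi hA hB => exact ⟨_, _, rfl, hA, hB⟩

/-- The role at which the type annotation reduces is arbitrary, so it can be taken to be `rep`. -/
theorem Par.cpi_inv {Ω : List Role} {a b A B t : Tm K} {R₁ R : Role}
    (h : Par S Ω (.cpi a b A R₁ B) t R) :
    ∃ a' b' A' B', t = .cpi a' b' A' R₁ B' ∧ Par S Ω a a' R₁ ∧ Par S Ω b b' R₁ ∧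
      Par S Ω A A' .rep ∧ Par S Ω B B' R := by
  cases h with
  | refl h =>
    cases h with
    | cpi ha hb hA hB =>
      exact ⟨_, _, _, _, rfl, .refl ha, .refl hb, .refl (hA.mono (.repTop _)), .refl hB⟩
  | cpi ha hb hA hB => exact ⟨_, _, _, _, rfl, ha, hb, hA.mono (.repTop _), hB⟩

/-- `Unfolds S R a a' t`: at role `R`, an axiom of `S` whose pattern agrees with `a` unfolds `a'`
to `t`. -/
def Unfolds (S : Sig K) (R : Role) (a a' t : Tm K) : Prop :=
  ∃ F A Rs p R₁ b, (F, Decl.ax A Rs p R₁ b) ∈ S ∧ SubRole R₁ R ∧ PatAgree a p ∧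
    MatchSubst a' p b t

theorem Par.app_inv {Ω : List Role} {a b t : Tm K} {ν : AppFlag} {R : Role}
    (h : Par S Ω (.app a ν b) t R) :
    ∃ a' b', Par S Ω a a' R ∧ Par S Ω b b' (ν.argRole R) ∧
      (t = .app a' ν b' ∨ (∃ ρ c, ν = .rho ρ ∧ a' = .lam ρ c ∧ t = c.inst b') ∨
        Unfolds S R (.app a ν b) (.app a' ν b') t) := by
  cases h with
  | refl h =>
    rw [roleing_app_iff] at h
    exact ⟨_, _, .refl h.1, .refl h.2, .inl rfl⟩
  | beta ha hb => exact ⟨_, _, ha, hb, .inr (.inl ⟨_, _, rfl, rfl, rfl⟩)⟩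
  | app ha hb => exact ⟨_, _, ha, hb, .inl rfl⟩
  | axiomApp hF hR hp ha hb hm =>
    exact ⟨_, _, ha, hb, .inr (.inr ⟨_, _, _, _, _, _, hF, hR, hp, hm⟩)⟩

theorem Par.capp_inv {Ω : List Role} {a t : Tm K} {R : Role} (h : Par S Ω (.capp a) t R) :
    ∃ a', Par S Ω a a' R ∧
      (t = .capp a' ∨ a' = .clam t ∨ Unfolds S R (.capp a) (.capp a') t) := by
  cases h with
  | refl h =>
    cases h with
    | capp h => exact ⟨_, .refl h, .inl rfl⟩
  | cbeta ha => exact ⟨_, ha, .inr (.inl rfl)⟩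
  | capp ha => exact ⟨_, ha, .inl rfl⟩
  | axiomCApp hF hR hp ha hm =>
    exact ⟨_, ha, .inr (.inr ⟨_, _, _, _, _, _, hF, hR, hp, hm⟩)⟩

theorem Par.case_inv {Ω : List Role} {a b₁ b₂ t : Tm K} {F : K} {υs : List AnyFlag} {R : Role}
    (h : Par S Ω (.case a F υs b₁ b₂) t R) :
    ∃ a' b₁' b₂', Par S Ω a a' .nom ∧ Par S Ω b₁ b₁' R ∧ Par S Ω b₂ b₂' R ∧
      (t = .case a' F υs b₁' b₂' ∨
        (AppsPath S .nom a' F υs ∧ SatApp S F υs ∧ ∃ c, ApplyArgs a' b₁' c ∧ t = .capp c) ∨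
        (Value S .nom a' ∧ ¬ AppsPath S .nom a' F υs ∧ t = b₂')) := by
  cases h with
  | refl h =>
    cases h with
    | case h h₁ h₂ => exact ⟨_, _, _, .refl h, .refl h₁, .refl h₂, .inl rfl⟩
  | case h h₁ h₂ => exact ⟨_, _, _, h, h₁, h₂, .inl rfl⟩
  | caseTrue h h₁ h₂ hp hs hb =>
    exact ⟨_, _, _, h, h₁, h₂, .inr (.inl ⟨hp, hs, _, hb, rfl⟩)⟩
  | caseFalse h h₁ h₂ hv hn => exact ⟨_, _, _, h, h₁, h₂, .inr (.inr ⟨hv, hn, rfl⟩)⟩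

/-! ### Inert paths -/

/-- No prefix of `a` is an instance of the pattern of an axiom for `F` usable at role `R`. -/
def Inert (S : Sig K) (R : Role) (a : Tm K) (F : K) : Prop :=
  ∀ {A Rs p R₁ b}, (F, Decl.ax A Rs p R₁ b) ∈ S → SubRole R₁ R → ¬ PrefixAgree a p

/-- Paths reduced argument by argument, each argument at the role given by its flag. -/
abbrev PathPar (S : Sig K) (Ω : List Role) (R : Role) : Tm K → Tm K → Prop :=
  PathRel fun ν b b' => Par S Ω b b' (ν.argRole R)

/-- An inert path reduces only by reducing its arguments. -/
theorem ValuePath.pathRel_of_par (hS : SigOk S S) {Ω : List Role} {R : Role} {a a' : Tm K}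
    {F : K} (ha : ValuePath S a F) (hi : Inert S R a F) (h : Par S Ω a a' R) :
    PathPar S Ω R a a' := by
  -- An axiom whose pattern agrees with a path headed by `F` is an axiom for `F`.
  have hax {a a' t : Tm K} (ha : ValuePath S a F) (hi : Inert S R a F) :
      ¬ Unfolds S R a a' t := by
    rintro ⟨G, A, Rs, p, R₁, b, hG, hR, ⟨as, hm⟩, -⟩
    obtain rfl : G = F := (hS.axiom_ok hG).1.symm.trans (hm.head_eq ha)
    exact hi hG hR (.base ⟨as, hm⟩)
  induction a generalizing a' with
  | star | var | lam | box | pi | clam | cpi | case => cases ha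
  | fam =>
    cases ha
    cases h with
    | refl => exact .fam _
    | axiomBase hF hR => exact absurd (.base ⟨_, .fam⟩) (hi hF hR)
  | app a ν b iha _ =>
    obtain ⟨ha', hb⟩ := valuePath_app_iff.1 ha
    obtain ⟨c, d, hc, hd, h⟩ := h.app_inv
    have hac := iha ha' (fun hF hR hp => hi hF hR hp.app) hc
    rcases h with rfl | ⟨_, _, -, rfl, -⟩ | h
    · refine .app hac (fun e => ⟨hb e, ?_⟩) hd
      rw [hb e] at hd
      exact hd.box_inv
    · cases hac
    · exact absurd h (hax ha hi)
  | capp a iha =>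
    cases ha with
    | capp ha' =>
      obtain ⟨c, hc, h⟩ := h.capp_inv
      have hac := iha ha' (fun hF hR hp => hi hF hR hp.capp) hc
      rcases h with rfl | rfl | h
      · exact .capp hac
      · cases hac
      · exact absurd h (hax (.capp ha') hi)

theorem AppsPath.inert (hS : SigOk S S) {a : Tm K} {F : K} {υs : List AnyFlag} {R : Role}
    (h : AppsPath S R a F υs) : Inert S R a F := by
  intro A Rs p R₁ b hF hR hp
  clear hp
  induction h with
  | absConst hF' => cases hS.unique hF hF'
  | const hF' hR' =>
    cases hS.unique hF hF'
    exact hR' hR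
  | appRole _ ih | appRel _ ih | appIrr _ ih | capp _ ih => exact ih hF

theorem CasePath.inert (hS : SigOk S S) {a : Tm K} {F : K} {R : Role} (h : CasePath S R a F) :
    Inert S R a F := by
  intro A Rs p R₁ b hF hR hp
  cases h with
  | absConst _ hF' => cases hS.unique hF hF'
  | const _ hF' hR' =>
    cases hS.unique hF hF'
    exact hR' hR
  | unMatch _ hF' hp' =>
    cases hS.unique hF hF'
    exact hp' hp

theorem AppsPath.par (hS : SigOk S S) {Ω : List Role} {a a' : Tm K} {F : K}
    {υs : List AnyFlag} {R : Role} (ha : AppsPath S R a F υs) (h : Par S Ω a a' R) :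
    AppsPath S R a' F υs :=
  (ha.valuePath.pathRel_of_par hS (ha.inert hS) h).sameShape.appsPath ha

/-- Values reduce to values, and a value does not reduce to a path of a new shape. -/
theorem Value.par (hS : SigOk S S) {Ω : List Role} {a a' : Tm K} {R : Role} (ha : Value S R a)
    (h : Par S Ω a a' R) :
    Value S R a' ∧
      ∀ {F : K} {υs : List AnyFlag}, AppsPath S R a' F υs → AppsPath S R a F υs := by
  induction ha generalizing Ω a' with
  | star =>
    cases h.star_inv
    exact ⟨.star, id⟩
  | pi =>
    obtain ⟨_, _, rfl, -⟩ := h.pi_inv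
    exact ⟨.pi, fun h => by cases h⟩
  | cpi =>
    obtain ⟨_, _, _, _, rfl, -⟩ := h.cpi_inv
    exact ⟨.cpi, fun h => by cases h⟩
  | lamRel =>
    obtain ⟨_, rfl, -⟩ := h.lam_inv
    exact ⟨.lamRel, fun h => by cases h⟩
  | lamIrr _ ih =>
    obtain ⟨_, rfl, hb⟩ := h.lam_inv
    exact ⟨.lamIrr (ih hb).1, fun h => by cases h⟩
  | clam =>
    obtain ⟨_, rfl, -⟩ := h.clam_inv
    exact ⟨.clam, fun h => by cases h⟩
  | path ha =>
    have hs := (ha.valuePath.pathRel_of_par hS (ha.inert hS) h).sameShape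
    exact ⟨.path (hs.casePath ha), hs.symm.appsPath⟩

theorem ApplyArgs.par {Ω : List Role} {a a' b b' c c' : Tm K} {R : Role}
    (h : ApplyArgs a b c) (h' : ApplyArgs a' b' c') (ha : PathPar S Ω .nom a a')
    (hb : Par S Ω b b' R) : Par S Ω c c' R := by
  induction h generalizing a' c' with
  | const =>
    cases ha
    cases h'
    exact hb
  | appRole _ ih =>
    cases ha with
    | app ha _ hr =>
      rw [AppFlag.argRole_nom] at hr
      cases h' with
      | appRole h' => exact .app (ih h' ha hb) hr
  | appRho _ ih =>
    cases ha with
    | app ha _ hr =>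
      cases h' with
      | appRho h' => exact .app (ih h' ha hb) hr
  | capp _ ih =>
    cases ha with
    | capp ha =>
      cases h' with
      | capp h' => exact .capp (ih h' ha hb)

/-! ### Joining the contracta of an axiom -/

/-- When a path is reduced argument by argument, the terms matched by a pattern are reduced at the
roles of the pattern variables. -/
theorem Match.pathPar {Ω : List Role} {a a' : Tm K} {p : Pat K} {as : List (Tm K)} {R : Role}
    (hm : Match a p as) (h : PathPar S Ω R a a') :
    ∃ as', Match a' p as' ∧ ∀ {i : ℕ} {R₁ : Role}, p.ctx[i]? = some R₁ →
      Par S Ω (Tm.ofList as i) (Tm.ofList as' i) R₁ := by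
  induction hm generalizing a' with
  | fam =>
    cases h
    exact ⟨_, .fam, fun hi => by simp [Pat.ctx] at hi⟩
  | appRole _ ih =>
    cases h with
    | app h _ hr =>
      obtain ⟨as', hm, has⟩ := ih h
      refine ⟨_, .appRole hm, fun {i _} hi => ?_⟩
      cases i with
      | zero =>
        cases hi
        exact hr.mono (Role.meet_le_left _ _)
      | succ i => exact has hi
  | appRel _ ih =>
    cases h with
    | app h _ hr =>
      obtain ⟨as', hm, has⟩ := ih h
      refine ⟨_, .appRel hm, fun {i _} hi => ?_⟩
      cases i with
      | zero =>
        cases hi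
        exact hr
      | succ i => exact has hi
  | appIrr _ ih =>
    cases h with
    | app h hb _ =>
      obtain ⟨as', hm, has⟩ := ih h
      rw [(hb rfl).2]
      exact ⟨_, .appIrr hm, has⟩
  | capp _ ih =>
    cases h with
    | capp h =>
      obtain ⟨as', hm, has⟩ := ih h
      exact ⟨_, .capp hm, has⟩

theorem Unfolds.matchSubst (hS : SigOk S S) {F : K} {A : Tm K} {Rs : List Role} {p : Pat K}
    {R₁ R : Role} {a a' b t : Tm K} (h : Unfolds S R a a' t)
    (hF : (F, Decl.ax A Rs p R₁ b) ∈ S) (hp : PatAgree a p) : MatchSubst a' p b t := by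
  obtain ⟨G, A', Rs', q, R₂, b', hG, -, ⟨_, hq⟩, hm⟩ := h
  obtain ⟨_, hp⟩ := hp
  obtain rfl := (hq.unique hp).1
  obtain rfl : G = F := (hS.axiom_ok hG).1.symm.trans (hS.axiom_ok hF).1
  cases hS.unique hG hF
  exact hm

/-- A proper prefix of an instance of the pattern of an axiom is an inert path. -/
theorem Match.inert (hS : SigOk S S) {F : K} {A : Tm K} {Rs : List Role} {p q : Pat K}
    {R₁ : Role} {a b : Tm K} {as : List (Tm K)} (hF : (F, Decl.ax A Rs p R₁ b) ∈ S)
    (hm : Match a q as) (hq : q.head = p.head) (hlt : sizeOf q < sizeOf p) (R : Role) :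
    ValuePath S a F ∧ Inert S R a F := by
  rw [(hS.axiom_ok hF).1] at hq
  subst hq
  refine ⟨hm.valuePath hF, fun hF' _ hp => ?_⟩
  cases hS.unique hF' hF
  exact absurd (hp.sizeOf_le hm) (by omega)

theorem PatAgree.pathPar_app (hS : SigOk S S) {Ω : List Role} {F : K} {A : Tm K}
    {Rs : List Role} {p : Pat K} {R₁ R : Role} {a a' b b' e : Tm K} {ν : AppFlag}
    (hp : PatAgree (.app a ν b) p) (hF : (F, Decl.ax A Rs p R₁ e) ∈ S) (ha : Par S Ω a a' R)
    (hb : Par S Ω b b' (ν.argRole R)) : PathPar S Ω R (.app a ν b) (.app a' ν b') := by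
  obtain ⟨as, hm⟩ := hp
  cases hm with
  | appRole hm =>
    obtain ⟨hv, hi⟩ := hm.inert hS hF rfl (by simp; omega) R
    exact .app (hv.pathRel_of_par hS hi ha) (by simp) hb
  | appRel hm =>
    obtain ⟨hv, hi⟩ := hm.inert hS hF rfl (by simp) R
    exact .app (hv.pathRel_of_par hS hi ha) (by simp) hb
  | appIrr hm =>
    obtain ⟨hv, hi⟩ := hm.inert hS hF rfl (by simp) R
    exact .app (hv.pathRel_of_par hS hi ha) (fun _ => ⟨rfl, hb.box_inv⟩) hb

theorem PatAgree.pathPar_capp (hS : SigOk S S) {Ω : List Role} {F : K} {A : Tm K}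
    {Rs : List Role} {p : Pat K} {R₁ R : Role} {a a' e : Tm K} (hp : PatAgree (.capp a) p)
    (hF : (F, Decl.ax A Rs p R₁ e) ∈ S) (ha : Par S Ω a a' R) :
    PathPar S Ω R (.capp a) (.capp a') := by
  obtain ⟨as, hm⟩ := hp
  cases hm with
  | capp hm =>
    obtain ⟨hv, hi⟩ := hm.inert hS hF rfl (by simp) R
    exact .capp (hv.pathRel_of_par hS hi ha)

/-- Unfolding an axiom commutes with reduction of the arguments. The right-hand side has role `R₁`
in the context of the pattern, which is what the substitution lemma needs. -/
theorem MatchSubst.par (hS : SigOk S S) {Ω : List Role} {F : K} {A : Tm K} {Rs : List Role}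
    {p : Pat K} {R₁ R : Role} {a a' b t t' : Tm K} (hF : (F, Decl.ax A Rs p R₁ b) ∈ S)
    (hR : SubRole R₁ R) (h : PathPar S Ω R a a') (ht : MatchSubst a p b t)
    (ht' : MatchSubst a' p b t') : Par S Ω t t' R := by
  obtain ⟨as, hm, rfl⟩ := ht
  obtain ⟨bs, hm', rfl⟩ := ht'
  obtain ⟨cs, hm'', has⟩ := hm.pathPar h
  obtain rfl := (hm'.unique hm'').2
  exact ((Par.refl (hS.axiom_ok hF).2).subst hS has).mono hR

theorem PatAgree.exists_matchSubst {a : Tm K} {p : Pat K} (h : PatAgree a p) (b : Tm K) :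
    ∃ t, MatchSubst a p b t :=
  let ⟨as, h⟩ := h
  ⟨_, as, h, rfl⟩

/-! ### The diamond property -/

/-- Let the reducts `a₁` of `a` and `b₁` of `b` reduce to `c` and `d`. Then all reducts of `a b^ν`
built from reducts of `a` and `b` that also reduce to `c` and `d` reduce to one term: the contractum
of an axiom if one applies, a `β`-contractum if `c` is a matching abstraction, and `c d^ν`
otherwise. -/
theorem exists_join_app (hS : SigOk S S) {Ω : List Role} {a a₁ b b₁ c d : Tm K} {ν : AppFlag}
    {R : Role} (ha₁ : Par S Ω a a₁ R) (hb₁ : Par S Ω b b₁ (ν.argRole R)) (hc₁ : Par S Ω a₁ c R)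
    (hd₁ : Par S Ω b₁ d (ν.argRole R)) :
    ∃ u, ∀ {a' b' t : Tm K}, Par S Ω a a' R → Par S Ω b b' (ν.argRole R) →
      Par S Ω a' c R → Par S Ω b' d (ν.argRole R) →
      (t = .app a' ν b' ∨ (∃ ρ e, ν = .rho ρ ∧ a' = .lam ρ e ∧ t = e.inst b') ∨
        Unfolds S R (.app a ν b) (.app a' ν b') t) → Par S Ω t u R := by
  by_cases hax : ∃ F A Rs p R₁ e, (F, Decl.ax A Rs p R₁ e) ∈ S ∧ SubRole R₁ R ∧
      PatAgree (.app a ν b) p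
  · obtain ⟨F, A, Rs, p, R₁, e, hF, hR, hp⟩ := hax
    have hp₁ := (hp.pathPar_app hS hF ha₁ hb₁).sameShape.patAgree hp
    have hp₂ := (hp₁.pathPar_app hS hF hc₁ hd₁).sameShape.patAgree hp₁
    obtain ⟨u, hu⟩ := hp₂.exists_matchSubst e
    refine ⟨u, fun {a' b' t} ha hb hc hd ht => ?_⟩
    have hpath := hp.pathPar_app hS hF ha hb
    have hp' := hpath.sameShape.patAgree hp
    rcases ht with rfl | ⟨_, _, -, rfl, -⟩ | ht
    · exact .axiomApp hF hR hp' hc hd hu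
    · cases hpath with
      | app h => cases h
    · exact MatchSubst.par hS hF hR (hp'.pathPar_app hS hF hc hd) (ht.matchSubst hS hF hp) hu
  have hno {a' t : Tm K} : ¬ Unfolds S R (.app a ν b) a' t :=
    fun ⟨F, A, Rs, p, R₁, e, hF, hR, hp, _⟩ => hax ⟨F, A, Rs, p, R₁, e, hF, hR, hp⟩
  by_cases hlam : ∃ ρ e, ν = .rho ρ ∧ c = .lam ρ e
  · obtain ⟨ρ, e, rfl, rfl⟩ := hlam
    refine ⟨e.inst d, fun {a' b' t} _ _ hc hd ht => ?_⟩
    rcases ht with rfl | ⟨_, f, -, rfl, rfl⟩ | ht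
    · exact .beta hc hd
    · obtain ⟨_, h, hf⟩ := hc.lam_inv
      cases h
      exact hf.inst hS hd
    · exact absurd ht hno
  · refine ⟨.app c ν d, fun {a' b' t} _ _ hc hd ht => ?_⟩
    rcases ht with rfl | ⟨ρ, _, rfl, rfl, rfl⟩ | ht
    · exact .app hc hd
    · obtain ⟨e, rfl, -⟩ := hc.lam_inv
      exact absurd ⟨ρ, e, rfl, rfl⟩ hlam
    · exact absurd ht hno

/-- The analogue of `exists_join_app` for `a •`. -/
theorem exists_join_capp (hS : SigOk S S) {Ω : List Role} {a a₁ c : Tm K} {R : Role}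
    (ha₁ : Par S Ω a a₁ R) (hc₁ : Par S Ω a₁ c R) :
    ∃ u, ∀ {a' t : Tm K}, Par S Ω a a' R → Par S Ω a' c R →
      (t = .capp a' ∨ a' = .clam t ∨ Unfolds S R (.capp a) (.capp a') t) → Par S Ω t u R := by
  by_cases hax : ∃ F A Rs p R₁ e, (F, Decl.ax A Rs p R₁ e) ∈ S ∧ SubRole R₁ R ∧
      PatAgree (.capp a) p
  · obtain ⟨F, A, Rs, p, R₁, e, hF, hR, hp⟩ := hax
    have hp₁ := (hp.pathPar_capp hS hF ha₁).sameShape.patAgree hp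
    have hp₂ := (hp₁.pathPar_capp hS hF hc₁).sameShape.patAgree hp₁
    obtain ⟨u, hu⟩ := hp₂.exists_matchSubst e
    refine ⟨u, fun {a' t} ha hc ht => ?_⟩
    have hpath := hp.pathPar_capp hS hF ha
    have hp' := hpath.sameShape.patAgree hp
    rcases ht with rfl | rfl | ht
    · exact .axiomCApp hF hR hp' hc hu
    · cases hpath with
      | capp h => cases h
    · exact MatchSubst.par hS hF hR (hp'.pathPar_capp hS hF hc) (ht.matchSubst hS hF hp) hu
  have hno {a' t : Tm K} : ¬ Unfolds S R (.capp a) a' t :=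
    fun ⟨F, A, Rs, p, R₁, e, hF, hR, hp, _⟩ => hax ⟨F, A, Rs, p, R₁, e, hF, hR, hp⟩
  by_cases hlam : ∃ e, c = .clam e
  · obtain ⟨e, rfl⟩ := hlam
    refine ⟨e, fun {a' t} _ hc ht => ?_⟩
    rcases ht with rfl | rfl | ht
    · exact .cbeta hc
    · obtain ⟨_, h, ht⟩ := hc.clam_inv
      cases h
      exact ht
    · exact absurd ht hno
  · refine ⟨.capp c, fun {a' t} _ hc ht => ?_⟩
    rcases ht with rfl | rfl | ht
    · exact .capp hc
    · obtain ⟨e, rfl, -⟩ := hc.clam_inv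
      exact absurd ⟨e, rfl⟩ hlam
    · exact absurd ht hno

/-- The analogue of `exists_join_app` for `case`: the common reduct depends on whether the common
reduct `c` of the scrutinee selects the first branch, the second, or neither. -/
theorem exists_join_case (hS : SigOk S S) {Ω : List Role} {c d₁ d₂ : Tm K} {F : K}
    {υs : List AnyFlag} {R : Role} :
    ∃ u, ∀ {a' b₁' b₂' t : Tm K}, Par S Ω a' c .nom → Par S Ω b₁' d₁ R → Par S Ω b₂' d₂ R →
      (t = .case a' F υs b₁' b₂' ∨
        (AppsPath S .nom a' F υs ∧ SatApp S F υs ∧ ∃ e, ApplyArgs a' b₁' e ∧ t = .capp e) ∨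
        (Value S .nom a' ∧ ¬ AppsPath S .nom a' F υs ∧ t = b₂')) → Par S Ω t u R := by
  by_cases hc : AppsPath S .nom c F υs ∧ SatApp S F υs
  · obtain ⟨u, hu⟩ := hc.1.exists_applyArgs d₁
    refine ⟨.capp u, fun {a' b₁' b₂' t} h h₁ h₂ ht => ?_⟩
    rcases ht with rfl | ⟨hp, -, e, he, rfl⟩ | ⟨hv, hn, -⟩
    · exact .caseTrue h h₁ h₂ hc.1 hc.2 hu
    · exact .capp (he.par hu (hp.valuePath.pathRel_of_par hS (hp.inert hS) h) h₁)
    · exact absurd ((hv.par hS h).2 hc.1) hn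
  by_cases hv : Value S .nom c ∧ ¬ AppsPath S .nom c F υs
  · refine ⟨d₂, fun {a' b₁' b₂' t} h h₁ h₂ ht => ?_⟩
    rcases ht with rfl | ⟨hp, hs, -⟩ | ⟨-, -, rfl⟩
    · exact .caseFalse h h₁ h₂ hv.1 hv.2
    · exact absurd ⟨hp.par hS h, hs⟩ hc
    · exact h₂
  · refine ⟨.case c F υs d₁ d₂, fun {a' b₁' b₂' t} h h₁ h₂ ht => ?_⟩
    rcases ht with rfl | ⟨hp, hs, -⟩ | ⟨hv', hn, -⟩
    · exact .case h h₁ h₂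
    · exact absurd ⟨hp.par hS h, hs⟩ hc
    · exact absurd ⟨(hv'.par hS h).1, fun hp => hn ((hv'.par hS h).2 hp)⟩ hv

theorem exists_join_fam (hS : SigOk S S) {Ω : List Role} {F : K} {R : Role}
    (hF : Roleing S Ω (.fam F) R) :
    ∃ u, ∀ {t : Tm K}, Par S Ω (.fam F) t R → Par S Ω t u R := by
  by_cases hax : ∃ A Rs R₁ b, (F, Decl.ax A Rs (.fam F) R₁ b) ∈ S ∧ SubRole R₁ R
  · obtain ⟨A, Rs, R₁, b, hb, hR⟩ := hax
    have hpar : Par S Ω (.fam F) b R := .axiomBase hb hR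
    refine ⟨b, fun {t} h => ?_⟩
    cases h with
    | refl => exact hpar
    | axiomBase hb' _ =>
      cases hS.unique hb hb'
      exact .refl (hpar.roleing_right hS)
  · refine ⟨.fam F, fun {t} h => ?_⟩
    cases h with
    | refl => exact .refl hF
    | axiomBase hb hR => exact absurd ⟨_, _, _, _, hb, hR⟩ hax

/-- The diamond property, by induction on the source, for all contexts and roles. -/
theorem Par.diamond (hS : SigOk S S) {Ω : List Role} {R : Role} {a a₁ a₂ : Tm K}
    (h₁ : Par S Ω a a₁ R) (h₂ : Par S Ω a a₂ R) :
    ∃ b, Par S Ω a₁ b R ∧ Par S Ω a₂ b R := by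
  induction a generalizing Ω R a₁ a₂ with
  | star =>
    cases h₁.star_inv
    exact ⟨a₂, h₂, .refl (h₂.roleing_right hS)⟩
  | box =>
    cases h₁.box_inv
    exact ⟨a₂, h₂, .refl (h₂.roleing_right hS)⟩
  | var =>
    cases h₁.var_inv
    exact ⟨a₂, h₂, .refl (h₂.roleing_right hS)⟩
  | fam F =>
    obtain ⟨u, hu⟩ := exists_join_fam hS h₁.roleing_left
    exact ⟨u, hu h₁, hu h₂⟩
  | lam ρ b ih =>
    obtain ⟨b₁, rfl, hb₁⟩ := h₁.lam_inv
    obtain ⟨b₂, rfl, hb₂⟩ := h₂.lam_inv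
    obtain ⟨c, hc₁, hc₂⟩ := ih hb₁ hb₂
    exact ⟨_, .lam hc₁, .lam hc₂⟩
  | clam b ih =>
    obtain ⟨b₁, rfl, hb₁⟩ := h₁.clam_inv
    obtain ⟨b₂, rfl, hb₂⟩ := h₂.clam_inv
    obtain ⟨c, hc₁, hc₂⟩ := ih hb₁ hb₂
    exact ⟨_, .clam hc₁, .clam hc₂⟩
  | pi ρ A B ihA ihB =>
    obtain ⟨A₁, B₁, rfl, hA₁, hB₁⟩ := h₁.pi_inv
    obtain ⟨A₂, B₂, rfl, hA₂, hB₂⟩ := h₂.pi_inv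
    obtain ⟨C, hC₁, hC₂⟩ := ihA hA₁ hA₂
    obtain ⟨D, hD₁, hD₂⟩ := ihB hB₁ hB₂
    exact ⟨_, .pi hC₁ hD₁, .pi hC₂ hD₂⟩
  | cpi a b A R₁ B iha ihb ihA ihB =>
    obtain ⟨a₁, b₁, A₁, B₁, rfl, ha₁, hb₁, hA₁, hB₁⟩ := h₁.cpi_inv
    obtain ⟨a₂, b₂, A₂, B₂, rfl, ha₂, hb₂, hA₂, hB₂⟩ := h₂.cpi_inv
    obtain ⟨c, hc₁, hc₂⟩ := iha ha₁ ha₂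
    obtain ⟨d, hd₁, hd₂⟩ := ihb hb₁ hb₂
    obtain ⟨C, hC₁, hC₂⟩ := ihA hA₁ hA₂
    obtain ⟨D, hD₁, hD₂⟩ := ihB hB₁ hB₂
    exact ⟨_, .cpi hc₁ hd₁ hC₁ hD₁, .cpi hc₂ hd₂ hC₂ hD₂⟩
  | app a ν b iha ihb =>
    obtain ⟨a₁, b₁, ha₁, hb₁, ht₁⟩ := h₁.app_inv
    obtain ⟨a₂, b₂, ha₂, hb₂, ht₂⟩ := h₂.app_inv
    obtain ⟨c, hc₁, hc₂⟩ := iha ha₁ ha₂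
    obtain ⟨d, hd₁, hd₂⟩ := ihb hb₁ hb₂
    obtain ⟨u, hu⟩ := exists_join_app hS ha₁ hb₁ hc₁ hd₁
    exact ⟨u, hu ha₁ hb₁ hc₁ hd₁ ht₁, hu ha₂ hb₂ hc₂ hd₂ ht₂⟩
  | capp a ih =>
    obtain ⟨a₁, ha₁, ht₁⟩ := h₁.capp_inv
    obtain ⟨a₂, ha₂, ht₂⟩ := h₂.capp_inv
    obtain ⟨c, hc₁, hc₂⟩ := ih ha₁ ha₂
    obtain ⟨u, hu⟩ := exists_join_capp hS ha₁ hc₁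
    exact ⟨u, hu ha₁ hc₁ ht₁, hu ha₂ hc₂ ht₂⟩
  | case a F υs b₁ b₂ ih ih₁ ih₂ =>
    obtain ⟨a', b', c', h, h', h'', ht⟩ := h₁.case_inv
    obtain ⟨a'', b'', c'', k, k', k'', kt⟩ := h₂.case_inv
    obtain ⟨c, hc₁, hc₂⟩ := ih h k
    obtain ⟨d, hd₁, hd₂⟩ := ih₁ h' k'
    obtain ⟨e, he₁, he₂⟩ := ih₂ h'' k''
    obtain ⟨u, hu⟩ := exists_join_case (c := c) (d₁ := d) (d₂ := e) (F := F) (υs := υs) (R := R) hS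
    exact ⟨u, hu hc₁ hd₁ he₁ ht, hu hc₂ hd₂ he₂ kt⟩

end SystemDR

theorem mainTheorem3 {K : Type*} (S₀ : SystemDR.Sig K) (hS₀ : SystemDR.SigOk S₀ S₀)
    (Ω : List SystemDR.Role) (R : SystemDR.Role) (a a₁ a₂ : SystemDR.Tm K)
    (h₁ : SystemDR.Par S₀ Ω a a₁ R) (h₂ : SystemDR.Par S₀ Ω a a₂ R) :
    ∃ b : SystemDR.Tm K, SystemDR.Par S₀ Ω a₁ b R ∧ SystemDR.Par S₀ Ω a₂ b R :=
  h₁.diamond hS₀ h₂
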